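/- Work over $\mathbb{C}$. A $(v_k,b_r)$-configuration of points and lines in a projective space consists of $v$ points and $b$ lines such that each of the points lies on exactly $k$ of the lines, each of the lines contains exactly $r$ of the points, different points lie on different sets of lines, and different lines contain different sets of points. Isomorphisms are pairs of bijections (of points and of lines) that preserve and reflect incidence. **Reye configuration.** By a Reye configuration $\mathcal R$ in $\mathbb{P}^3$ we mean one of the following. 1. The configuration of the cube $[-1,1]^3$. The points are the 8 vertices $[1:\pm1:\pm1:\pm1]$ of the cube, its centre, and the 3 points at infinity of its edges. The lines are the 12 edges and the 4 diagonals. 2. The configuration of a net of diagonal quadrics $\sum x_i^2=0$, $\sum a_ix_i^2=0$, $\sum b_ix_i^2=0$ $(0\le i\le 3)$ for which all $3\times3$ minors of the matrix with rows $(1,1,1,1)$, $(a_i)$, $(b_i)$ are nonzero. The points are the 8 base points of the net and the 4 vertices of the coordinate tetrahedron. The lines are the lines joining a vertex with a base point. **Hesse–Salmon configuration.** Let $C$ be a nonsingular plane cubic, and let $a,b,c$ be the three different points in which some line intersects $C$. A point of contact of a tangent from $a$ is a point $A\in C$ whose tangent line meets $C$ in the divisor $2A+a$. (So the tangent at $A$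 passes through $a$, and $a$ itself counts only if it is an inflection point.) The points of contact for $b$ and $c$ are defined in the same way. The Hesse–Salmon configuration $\mathcal H(C;a,b,c)$ has as its points all points of contact of tangents from $a$, $b$ and $c$. Its lines are the lines that contain a point of contact of a tangent from $a$, one of a tangent from $b$ and one of a tangent from $c$. **Theorem.** Let $\mathcal R$ be a Reye configuration. 1. $\mathcal R$ is a $(12_4,16_3)$-configuration. 2. For every nonsingular plane cubic $C$ and all different collinear points $a,b,c\in C$, there are exactly four points of contact for each of $a,b,c$, and $\mathcal H(C;a,b,c)$ is a $(12_4,16_3)$-configuration. 3. Let $x$ be a general point of $\mathbb{P}^3$, that is, any point outside a certain surface $\{G=0\}$, where $G\ne0$ is a homogeneous polynomial that depends only on $\mathcal R$. Let $\pi:\mathbb{P}^3\dashrightarrow\mathbb{P}^2$ be any linear projection with centre $x$. Then: - $\pi(\mathcal R)$ is a $(12_4,16_3)$-configuration of points and lines in $\mathbb{P}^2$, and $\pi$ induces an isomorphism $\mathcal R\cong\pi(\mathcal R)$; - there are a nonsingular plane cubic $C\subset\mathbb{P}^2$ and three different collinear points $a,b,c\in C$ such that $\pi(\mathcal R)=\mathcal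 H(C;a,b,c)$, with the same 12 points and the same 16 lines; - $\pi(\mathcal R)$ is isomorphic to $\mathcal H(C';a',b',c')$ for every nonsingular plane cubic $C'$ and all different collinear points $a',b',c'\in C'$. -/

import Mathlib

open scoped LinearAlgebra.Projectivization

noncomputable section

namespace ReyeHesseSalmon

/-- A system of points and lines in the complex projective space `ℙ(ℂⁿ)`. A line is given by the
linear subspace over it (see `IsConfiguration` for the condition that its dimension is two). -/
@[ext]
structure PointLineSystem (n : ℕ) where
  points : Set (ℙ ℂ (Fin n → ℂ))
  lines : Set (Submodule ℂ (Fin n → ℂ))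

namespace PointLineSystem

variable {m n : ℕ}

/-- Incidence: the point `p` lies on the line `l`. -/
def Incident (R : PointLineSystem n) (p : R.points) (l : R.lines) : Prop :=
  p.1.submodule ≤ l.1

/-- The system is a `(v_k, b_r)`-configuration of points and lines: it has `v` points and `b`
(honest, projective) lines, every point is on exactly `k` of the lines, every line contains exactly
`r` of the points; moreover, different points are on different sets of lines, and different lines
contain different sets of points. -/
structure IsConfiguration (R : PointLineSystem n) (v k b r : ℕ) : Prop where
  finrank_line : ∀ l ∈ R.lines, Module.finrank ℂ l = 2
  points_finite : R.points.Finite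
  lines_finite : R.lines.Finite
  points_ncard : R.points.ncard = v
  lines_ncard : R.lines.ncard = b
  lines_through : ∀ p : R.points, {l : R.lines | R.Incident p l}.ncard = k
  points_on : ∀ l : R.lines, {p : R.points | R.Incident p l}.ncard = r
  point_ext : ∀ p q : R.points, (∀ l : R.lines, R.Incident p l ↔ R.Incident q l) → p = q
  line_ext : ∀ l l' : R.lines, (∀ p : R.points, R.Incident p l ↔ R.Incident p l') → l = l'

/-- An isomorphism of configurations: bijections on points and on lines which preserve and reflect
incidence. -/
structure Iso (R : PointLineSystem m) (S : PointLineSystem n) where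
  pointEquiv : R.points ≃ S.points
  lineEquiv : R.lines ≃ S.lines
  incident_iff : ∀ (p : R.points) (l : R.lines),
    S.Incident (pointEquiv p) (lineEquiv l) ↔ R.Incident p l

/-- The image of a system of points and lines under the rational map of projective spaces which is
induced by a linear map `φ` (points are mapped to points where the rational map is defined). -/
def image (φ : (Fin m → ℂ) →ₗ[ℂ] (Fin n → ℂ)) (R : PointLineSystem m) : PointLineSystem n where
  points := {q | ∃ p ∈ R.points, q.submodule = p.submodule.map φ}
  lines := {l | ∃ l' ∈ R.lines, l = l'.map φ}

end PointLineSystem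

/-! ### The Reye configuration -/

/-- The point `[0 : … : 1 : … : 0]`, a vertex of the coordinate tetrahedron of `ℙ³`. -/
def tetrahedronVertex (i : Fin 4) : Submodule ℂ (Fin 4 → ℂ) :=
  Submodule.span ℂ {Pi.single i 1}

/-- Homogeneous coordinates `(1, ±1, ±1, ±1)` of a vertex of the cube `[-1, 1]³`. -/
def cubeVertex (s : Fin 3 → ℤˣ) : Fin 4 → ℂ :=
  Fin.cons 1 fun i => ((s i : ℤ) : ℂ)

/-- The Reye configuration of the cube `[-1, 1]³`. The points are the eight vertices of the cube,
its centre `[1 : 0 : 0 : 0]` and the three points at infinity of its edges; the lines are the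
twelve edges (the endpoints differ in one coordinate) and the four diagonals (the endpoints are
opposite). -/
def reyeCube : PointLineSystem 4 where
  points := {p | (∃ s, p.submodule = Submodule.span ℂ {cubeVertex s}) ∨
    ∃ i, p.submodule = tetrahedronVertex i}
  lines := {l | (∃ s i, l =
      Submodule.span ℂ {cubeVertex s, cubeVertex (Function.update s i (-s i))}) ∨
    ∃ s, l = Submodule.span ℂ {cubeVertex s, cubeVertex (-s)}}

/-- All `3 × 3` minors of the matrix with rows `(1, 1, 1, 1)`, `a` and `b` are nonzero. -/
def NetIsGeneral (a b : Fin 4 → ℂ) : Prop :=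
  ∀ i : Fin 4, ((Matrix.of ![fun _ => 1, a, b]).submatrix id i.succAbove).det ≠ 0

/-- The base points of the net of quadrics spanned by
`∑ xᵢ² = 0`, `∑ aᵢ xᵢ² = 0` and `∑ bᵢ xᵢ² = 0`. -/
def netBasePoints (a b : Fin 4 → ℂ) : Set (ℙ ℂ (Fin 4 → ℂ)) :=
  {p | ∑ i, p.rep i ^ 2 = 0 ∧ ∑ i, a i * p.rep i ^ 2 = 0 ∧ ∑ i, b i * p.rep i ^ 2 = 0}

/-- The Reye configuration of a net of diagonal quadrics. The points are the base points of the net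
and the vertices of the coordinate tetrahedron; the lines join a vertex and a base point. -/
def reyeNet (a b : Fin 4 → ℂ) : PointLineSystem 4 where
  points := {p | p ∈ netBasePoints a b ∨ ∃ i, p.submodule = tetrahedronVertex i}
  lines := {l | ∃ i, ∃ p ∈ netBasePoints a b, l = tetrahedronVertex i ⊔ p.submodule}

/-- A Reye configuration in `ℙ³`, in either of its two constructions. -/
def IsReye (R : PointLineSystem 4) : Prop :=
  R = reyeCube ∨ ∃ a b : Fin 4 → ℂ, NetIsGeneral a b ∧ R = reyeNet a b

/-! ### The Hesse–Salmon configuration -/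

open MvPolynomial

/-- The plane curve `F = 0` of a homogeneous polynomial `F`. -/
def planeCurve (F : MvPolynomial (Fin 3) ℂ) : Set (ℙ ℂ (Fin 3 → ℂ)) :=
  {p | eval p.rep F = 0}

/-- `F = 0` is a nonsingular plane cubic. -/
structure IsNonsingularCubic (F : MvPolynomial (Fin 3) ℂ) : Prop where
  isHomogeneous : F.IsHomogeneous 3
  nonsingular : ∀ p ∈ planeCurve F, ∃ i, eval p.rep (pderiv i F) ≠ 0

/-- The tangent line at `p` of the curve `F = 0`. -/
def tangentLine (F : MvPolynomial (Fin 3) ℂ) (p : ℙ ℂ (Fin 3 → ℂ)) :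
    Submodule ℂ (Fin 3 → ℂ) :=
  LinearMap.ker (∑ i, eval p.rep (pderiv i F) • (LinearMap.proj i : (Fin 3 → ℂ) →ₗ[ℂ] ℂ))

/-- `p` is an inflection point of the nonsingular cubic `F = 0`: the tangent line at `p` meets the
cubic in no other point, that is, it meets the cubic with multiplicity three at `p`. -/
def IsInflectionPoint (F : MvPolynomial (Fin 3) ℂ) (p : ℙ ℂ (Fin 3 → ℂ)) : Prop :=
  p ∈ planeCurve F ∧ ∀ q ∈ planeCurve F, q.submodule ≤ tangentLine F p → q = p

/-- The points of contact of the tangents from the point `a` of the nonsingular cubic `C`. These are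
the points `A` of `C` at which the tangent line cuts out the divisor `2A + a` on `C`: the tangent
line at `A` passes through `a`, and the point `a` itself counts only if it is an inflection
point. -/
def contactPoints (F : MvPolynomial (Fin 3) ℂ) (a : ℙ ℂ (Fin 3 → ℂ)) :
    Set (ℙ ℂ (Fin 3 → ℂ)) :=
  {A | A ∈ planeCurve F ∧ a.submodule ≤ tangentLine F A ∧ (A = a → IsInflectionPoint F a)}

/-- `F = 0` is a nonsingular plane cubic and some line intersects it in the three different points
`a`, `b`, `c`. -/
structure IsHesseSalmonDatum (F : MvPolynomial (Fin 3) ℂ) (a b c : ℙ ℂ (Fin 3 → ℂ)) :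
    Prop where
  isNonsingularCubic : IsNonsingularCubic F
  mem_a : a ∈ planeCurve F
  mem_b : b ∈ planeCurve F
  mem_c : c ∈ planeCurve F
  ne_ab : a ≠ b
  ne_bc : b ≠ c
  ne_ac : a ≠ c
  collinear : ∃ l : Submodule ℂ (Fin 3 → ℂ), Module.finrank ℂ l = 2 ∧
    a.submodule ≤ l ∧ b.submodule ≤ l ∧ c.submodule ≤ l

/-- The Hesse–Salmon configuration. The points are the points of contact of the tangents to the
cubic `F = 0` from `a`, `b` and `c`; the lines are those which contain a point of contact of a
tangent from `a`, one from `b` and one from `c`. -/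
def hesseSalmon (F : MvPolynomial (Fin 3) ℂ) (a b c : ℙ ℂ (Fin 3 → ℂ)) :
    PointLineSystem 3 where
  points := contactPoints F a ∪ contactPoints F b ∪ contactPoints F c
  lines := {l | Module.finrank ℂ l = 2 ∧ ∃ A ∈ contactPoints F a, ∃ B ∈ contactPoints F b,
    ∃ C ∈ contactPoints F c, A.submodule ≤ l ∧ B.submodule ≤ l ∧ C.submodule ≤ l}

end ReyeHesseSalmon

end

open ReyeHesseSalmon

/-!
The twelve points of a Reye configuration are the vertices of three tetrahedra, and each of its
lines contains one vertex of each of them. If the vertices of each tetrahedron are labelled by the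
Klein four-group `V`, the lines are the triples `(s, t, s + t)`. This is also the structure of the
points of contact of the tangents from three collinear points of a cubic, with `V` as the group of
2-torsion points, but no group law is used below: every Hesse–Salmon configuration is shown to be
the projection of the configuration of the cube from a general point, and conversely.

*Projections.* The configuration of a net is the image of the configuration of the cube under a
diagonal map (`NetIsGeneral.exists_reyeNet_eq`), so that only images `ψ(reyeCube)` matter. If a
point and a line of the cube configuration are not incident, then the plane which contains both is
one of the planes `x_j = ± x_k`. Hence `ψ` preserves and reflects incidence as soon as its kernel is
at most a point `x` for which the squares `x_i²` are different (`map_reyeVecC_mem_iff`), and then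
the image has the same combinatorial structure (`isLabelledBy_image_reyeCube`). The polynomial `G`
is the product of the differences `x_i² - x_j²`.

*Normal form.* Let `a`, `b`, `c` be different collinear points of a nonsingular cubic. In
coordinates with `a = [0 : 0 : 1]`, `b = [1 : 0 : 1]`, `c = [1 : 0 : -1]` which are adapted to the
tangent at `a`, the cubic has an equation `H = 0` with
`X H = (X Z + e Y²)² - ∏ (X - q_i Y)` and `e² = ∏ q_i`, and one can choose `x` with `q_i = x_i²` and
`e = ∏ x_i` (`exists_normalForm`). The cubic is nonsingular if and only if the `q_i` are different
(`isNonsingularCubic_normalCubic`, `injective_of_isNonsingularCubic`). The points of contact of the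
tangents from `a` project from `a` to the four roots of the quartic (`contactPoints_normalCubic`);
in particular, there are four of them for each point of a collinear triple. Points with a
coordinate `x_i = 0` are not excluded: they correspond to inflection points `a`.

*Comparison.* The projection `normalProj x` maps the vertices of the coordinate tetrahedron to the
points of contact for `a`, with factors from Lagrange interpolation at the `q_i` which make its
kernel the point `x`. It maps the even and the odd vertices of the cube to points of contact for `b`
and `c` (`vertexImage_mem_contactPoints`), and by their number these are all
(`hesseSalmon_eq_image`). Conversely, any projection from `x` differs from `normalProj x` by a
linear change of coordinates of the plane, which transforms the cubic `H = 0` into the required one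
(`exists_hesseSalmon_eq_image`).
-/

open scoped LinearAlgebra.Projectivization

noncomputable section

namespace ReyeHesseSalmon

/-! ### Labelled systems of points and lines -/

namespace PointLineSystem

/-- The points and lines of `R` are listed by `pt` and `ln`, and the incidence relation of the
labels is `inc`. -/
structure IsLabelledBy {n : ℕ} {P L : Type} (R : PointLineSystem n) (inc : P → L → Prop)
    (pt : P → ℙ ℂ (Fin n → ℂ)) (ln : L → Submodule ℂ (Fin n → ℂ)) : Prop where
  points_eq : R.points = Set.range pt
  lines_eq : R.lines = Set.range ln
  finrank_line : ∀ l, Module.finrank ℂ (ln l) = 2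
  incident_iff : ∀ p l, (pt p).submodule ≤ ln l ↔ inc p l

namespace IsLabelledBy

variable {m n : ℕ} {P L : Type} {R : PointLineSystem n} {S : PointLineSystem m}
  {inc : P → L → Prop} {pt : P → ℙ ℂ (Fin n → ℂ)} {ln : L → Submodule ℂ (Fin n → ℂ)}
  {pt' : P → ℙ ℂ (Fin m → ℂ)} {ln' : L → Submodule ℂ (Fin m → ℂ)}

lemma pt_injective (h : R.IsLabelledBy inc pt ln)
    (hinc : ∀ p q, (∀ l, inc p l ↔ inc q l) → p = q) : Function.Injective pt := fun p q hpq =>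
  hinc p q fun l => by rw [← h.incident_iff, ← h.incident_iff, hpq]

lemma ln_injective (h : R.IsLabelledBy inc pt ln)
    (hinc : ∀ l l', (∀ p, inc p l ↔ inc p l') → l = l') : Function.Injective ln := fun l l' hl =>
  hinc l l' fun p => by rw [← h.incident_iff, ← h.incident_iff, hl]

/-- The bijection from the labels to the points of the system. -/
def equivPoints (h : R.IsLabelledBy inc pt ln)
    (hinc : ∀ p q, (∀ l, inc p l ↔ inc q l) → p = q) : P ≃ R.points :=
  (Equiv.ofInjective pt (h.pt_injective hinc)).trans (Equiv.setCongr h.points_eq.symm)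

/-- The bijection from the labels to the lines of the system. -/
def equivLines (h : R.IsLabelledBy inc pt ln)
    (hinc : ∀ l l', (∀ p, inc p l ↔ inc p l') → l = l') : L ≃ R.lines :=
  (Equiv.ofInjective ln (h.ln_injective hinc)).trans (Equiv.setCongr h.lines_eq.symm)

@[simp] lemma coe_equivPoints (h : R.IsLabelledBy inc pt ln)
    (hinc : ∀ p q, (∀ l, inc p l ↔ inc q l) → p = q) (p : P) :
    (h.equivPoints hinc p : ℙ ℂ (Fin n → ℂ)) = pt p := rfl

@[simp] lemma coe_equivLines (h : R.IsLabelledBy inc pt ln)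
    (hinc : ∀ l l', (∀ p, inc p l ↔ inc p l') → l = l') (l : L) :
    (h.equivLines hinc l : Submodule ℂ (Fin n → ℂ)) = ln l := rfl

/-- Being a configuration depends only on the incidence relation of the labels. -/
lemma isConfiguration [Fintype P] [Fintype L] (h : R.IsLabelledBy inc pt ln) {v k b r : ℕ}
    (hv : Nat.card P = v) (hb : Nat.card L = b) (hk : ∀ p, {l | inc p l}.ncard = k)
    (hr : ∀ l, {p | inc p l}.ncard = r) (hP : ∀ p q, (∀ l, inc p l ↔ inc q l) → p = q)
    (hL : ∀ l l', (∀ p, inc p l ↔ inc p l') → l = l') : R.IsConfiguration v k b r := by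
  have key : ∀ p l, R.Incident (h.equivPoints hP p) (h.equivLines hL l) ↔ inc p l :=
    fun p l => h.incident_iff p l
  refine ⟨?_, ?_, ?_, ?_, ?_, ?_, ?_, ?_, ?_⟩
  · rw [h.lines_eq]
    rintro _ ⟨l, rfl⟩
    exact h.finrank_line l
  · rw [h.points_eq]; exact Set.finite_range pt
  · rw [h.lines_eq]; exact Set.finite_range ln
  · rw [← hv, ← Nat.card_congr (h.equivPoints hP).symm, Nat.card_coe_set_eq]
  · rw [← hb, ← Nat.card_congr (h.equivLines hL).symm, Nat.card_coe_set_eq]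
  · intro p
    obtain ⟨p, rfl⟩ := (h.equivPoints hP).surjective p
    rw [← hk p, ← Set.ncard_image_of_injective _ (h.equivLines hL).injective,
      Equiv.image_eq_preimage_symm]
    congr 1
    ext l
    obtain ⟨l, rfl⟩ := (h.equivLines hL).surjective l
    simp [key]
  · intro l
    obtain ⟨l, rfl⟩ := (h.equivLines hL).surjective l
    rw [← hr l, ← Set.ncard_image_of_injective _ (h.equivPoints hP).injective,
      Equiv.image_eq_preimage_symm]
    congr 1
    ext p
    obtain ⟨p, rfl⟩ := (h.equivPoints hP).surjective p
    simp [key]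
  · intro p q hpq
    obtain ⟨p, rfl⟩ := (h.equivPoints hP).surjective p
    obtain ⟨q, rfl⟩ := (h.equivPoints hP).surjective q
    exact congrArg _ (hP p q fun l => by rw [← key, ← key]; exact hpq _)
  · intro l l' hl
    obtain ⟨l, rfl⟩ := (h.equivLines hL).surjective l
    obtain ⟨l', rfl⟩ := (h.equivLines hL).surjective l'
    exact congrArg _ (hL l l' fun p => by rw [← key, ← key]; exact hl _)

/-- Two systems with the same incidence relation of the labels are isomorphic. -/
def iso (h : R.IsLabelledBy inc pt ln) (h' : S.IsLabelledBy inc pt' ln')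
    (hP : ∀ p q, (∀ l, inc p l ↔ inc q l) → p = q)
    (hL : ∀ l l', (∀ p, inc p l ↔ inc p l') → l = l') : R.Iso S where
  pointEquiv := (h.equivPoints hP).symm.trans (h'.equivPoints hP)
  lineEquiv := (h.equivLines hL).symm.trans (h'.equivLines hL)
  incident_iff p l := by
    obtain ⟨p, rfl⟩ := (h.equivPoints hP).surjective p
    obtain ⟨l, rfl⟩ := (h.equivLines hL).surjective l
    simp only [Equiv.trans_apply, Equiv.symm_apply_apply, Incident, coe_equivPoints,
      coe_equivLines, h.incident_iff, h'.incident_iff]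

end IsLabelledBy

end PointLineSystem

/-! ### The abstract configuration and its coordinates -/

/-- Incidence in the abstract Reye configuration, with labels in the Klein four-group (the set
`Fin 4` with bitwise addition): the line `(s, t)` contains the points `(0, s)`, `(1, t)` and
`(2, s + t)`. -/
def ReyeInc (p : Fin 3 × Fin 4) (l : Fin 4 × Fin 4) : Prop :=
  p.2 = ![l.1, l.2, l.1 ^^^ l.2] p.1

instance (p : Fin 3 × Fin 4) (l : Fin 4 × Fin 4) : Decidable (ReyeInc p l) :=
  inferInstanceAs (Decidable (_ = _))

/-- Integral coordinates of the points of the cube configuration: the vertices of the coordinate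
tetrahedron, the vertices of the cube with an even number of minus signs, and the vertices with an
odd number of minus signs. -/
def reyeVec : Fin 3 × Fin 4 → Fin 4 → ℤ
  | (0, i) => ![![1, 0, 0, 0], ![0, 1, 0, 0], ![0, 0, 1, 0], ![0, 0, 0, 1]] i
  | (1, i) => ![![1, 1, 1, 1], ![1, 1, -1, -1], ![1, -1, 1, -1], ![1, -1, -1, 1]] i
  | (2, i) => ![![1, -1, -1, -1], ![1, -1, 1, 1], ![1, 1, -1, 1], ![1, 1, 1, -1]] i

lemma ReyeInc.point_ext : ∀ p q, (∀ l, ReyeInc p l ↔ ReyeInc q l) → p = q := by decide +kernel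

lemma ReyeInc.line_ext : ∀ l l', (∀ p, ReyeInc p l ↔ ReyeInc p l') → l = l' := by decide +kernel

lemma ReyeInc.ncard_lines (p) : {l | ReyeInc p l}.ncard = 4 := by
  rw [Set.ncard_eq_toFinset_card']
  revert p
  decide +kernel

lemma ReyeInc.ncard_points (l) : {p | ReyeInc p l}.ncard = 3 := by
  rw [Set.ncard_eq_toFinset_card']
  revert l
  decide +kernel

/-- The coordinates of the three points of a line of the cube configuration are linearly
dependent. -/
lemma ReyeInc.exists_combination : ∀ p l, ReyeInc p l → ∃ s ∈ ({-1, 0, 1} : Finset ℤ),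
    ∃ t ∈ ({-2, 0, 1, 2} : Finset ℤ), ∀ j,
      reyeVec p j = s * reyeVec (1, l.2) j + t * reyeVec (0, l.1) j := by
  decide +kernel

/-- If `p` is not on `l`, then the plane which contains both is one of the planes `x_j = ± x_k`,
and modulo the first point of `l` the point `p` is not a multiple of the second point of `l`. -/
lemma ReyeInc.exists_plane : ∀ p l, ¬ ReyeInc p l →
    (∃ j k, j ≠ k ∧ ∃ ε ∈ ({1, -1} : Finset ℤ), reyeVec (0, l.1) j = 0 ∧ reyeVec (0, l.1) k = 0 ∧
      reyeVec p j = ε * reyeVec p k ∧ reyeVec (1, l.2) j = ε * reyeVec (1, l.2) k) ∧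
    ∃ j m, reyeVec (0, l.1) j = 0 ∧ reyeVec (0, l.1) m = 0 ∧
      reyeVec p j * reyeVec (1, l.2) m ≠ reyeVec p m * reyeVec (1, l.2) j := by
  decide +kernel

/-- `reyeVec` with complex entries. -/
def reyeVecC (p : Fin 3 × Fin 4) : Fin 4 → ℂ := fun j => (reyeVec p j : ℂ)

/-- The line of the cube configuration with the label `l`, spanned by its first two points. -/
def reyeLine (l : Fin 4 × Fin 4) : Submodule ℂ (Fin 4 → ℂ) :=
  Submodule.span ℂ {reyeVecC (0, l.1), reyeVecC (1, l.2)}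

lemma reyeVecC_ne_zero (p) : reyeVecC p ≠ 0 := by
  have h : ∀ p, ∃ j, reyeVec p j ≠ 0 := by decide +kernel
  obtain ⟨j, hj⟩ := h p
  exact fun h0 => hj (by simpa [reyeVecC] using congrFun h0 j)

lemma reyeVecC_zero (i : Fin 4) : reyeVecC (0, i) = Pi.single i 1 := by
  have h : ∀ i j, reyeVec (0, i) j = if j = i then 1 else 0 := by decide +kernel
  ext j
  simp [reyeVecC, h, Pi.single_apply]

lemma exists_cubeVertex_eq : ∀ s, ∃ k v, cubeVertex s = reyeVecC (Fin.succ k, v) := by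
  have h : ∀ s : Fin 3 → ℤˣ, ∃ (k : Fin 2) (v : Fin 4),
      (Fin.cons 1 fun i => (s i : ℤ) : Fin 4 → ℤ) = reyeVec (k.succ, v) := by decide +kernel
  intro s
  obtain ⟨k, v, h⟩ := h s
  refine ⟨k, v, funext fun j => ?_⟩
  rw [reyeVecC, ← h]
  refine Fin.cases ?_ (fun i => ?_) j <;> simp [cubeVertex]

lemma exists_eq_cubeVertex : ∀ k v, ∃ s, reyeVecC (Fin.succ k, v) = cubeVertex s := by
  have h : ∀ (k : Fin 2) (v : Fin 4), ∃ s : Fin 3 → ℤˣ,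
      (Fin.cons 1 fun i => (s i : ℤ) : Fin 4 → ℤ) = reyeVec (k.succ, v) := by decide +kernel
  intro k v
  obtain ⟨s, h⟩ := h k v
  refine ⟨s, funext fun j => ?_⟩
  rw [reyeVecC, ← h]
  refine Fin.cases ?_ (fun i => ?_) j <;> simp [cubeVertex]

lemma reyeCube_points :
    reyeCube.points = {q | ∃ p, q.submodule = Submodule.span ℂ {reyeVecC p}} := by
  ext q
  constructor
  · rintro (⟨s, hs⟩ | ⟨i, hi⟩)
    · obtain ⟨k, v, h⟩ := exists_cubeVertex_eq s
      exact ⟨_, h ▸ hs⟩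
    · exact ⟨(0, i), by rw [hi, reyeVecC_zero, tetrahedronVertex]⟩
  · rintro ⟨⟨k, v⟩, h⟩
    revert h
    refine Fin.cases (fun h => ?_) (fun k h => ?_) k
    · exact Or.inr ⟨v, by rw [h, reyeVecC_zero, tetrahedronVertex]⟩
    · obtain ⟨s, hs⟩ := exists_eq_cubeVertex k v
      exact Or.inl ⟨s, by rw [h, hs]⟩

lemma reyeVecC_combination {p l} (h : ReyeInc p l) : ∃ s t : ℂ,
    reyeVecC p = s • reyeVecC (1, l.2) + t • reyeVecC (0, l.1) := by
  obtain ⟨s, -, t, -, h⟩ := h.exists_combination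
  exact ⟨s, t, funext fun j => by simp [reyeVecC, h]⟩

lemma reyeVecC_mem_reyeLine {p l} (h : ReyeInc p l) : reyeVecC p ∈ reyeLine l := by
  obtain ⟨s, t, h⟩ := reyeVecC_combination h
  rw [reyeLine, Submodule.mem_span_pair]
  exact ⟨t, s, by rw [h, add_comm]⟩

/-- If the kernel of `ψ` is at most a point `x` outside all planes `x_j = ± x_k`, then `ψ` reflects
the incidence of the cube configuration. -/
lemma map_reyeVecC_mem_iff {n : ℕ} {ψ : (Fin 4 → ℂ) →ₗ[ℂ] (Fin n → ℂ)} {x : Fin 4 → ℂ}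
    (hx : Function.Injective fun i => x i ^ 2) (hψ : LinearMap.ker ψ ≤ Submodule.span ℂ {x})
    (p l) : ψ (reyeVecC p) ∈ (reyeLine l).map ψ ↔ ReyeInc p l := by
  refine ⟨fun h => ?_, fun h => Submodule.mem_map_of_mem (reyeVecC_mem_reyeLine h)⟩
  by_contra hpl
  obtain ⟨y, hy, hyp⟩ := h
  obtain ⟨s, t, rfl⟩ := Submodule.mem_span_pair.1 hy
  have hker : reyeVecC p - (s • reyeVecC (0, l.1) + t • reyeVecC (1, l.2)) ∈ LinearMap.ker ψ := by
    rw [LinearMap.mem_ker, map_sub, hyp, sub_self]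
  obtain ⟨c, hc⟩ := Submodule.mem_span_singleton.1 (hψ hker)
  have hc' : ∀ j, c * x j =
      (reyeVec p j : ℂ) - (s * reyeVec (0, l.1) j + t * reyeVec (1, l.2) j) :=
    fun j => by simpa [reyeVecC] using congrFun hc j
  obtain ⟨⟨j, k, hjk, ε, hε, hj, hk, hp, hq⟩, i, m, hi, hm, hne⟩ := ReyeInc.exists_plane p l hpl
  have hε2 : (ε : ℂ) ^ 2 = 1 := by
    simp only [Finset.mem_insert, Finset.mem_singleton] at hε
    rcases hε with rfl | rfl <;> norm_num
  have hc0 : c = 0 := by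
    have h1 := hc' j
    have h2 := hc' k
    rw [hj, hp, hq] at h1
    rw [hk] at h2
    push_cast at h1 h2
    have h3 : c * x j = ε * (c * x k) := by rw [h1, h2]; ring
    have h4 : c ^ 2 * (x j ^ 2 - x k ^ 2) = 0 := by
      linear_combination (c * x j + ε * (c * x k)) * h3 + (c * x k) ^ 2 * hε2
    rcases mul_eq_zero.1 h4 with h | h
    · simpa using h
    · exact absurd (hx (sub_eq_zero.1 h)) hjk
  subst hc0
  have h1 := hc' i
  have h2 := hc' m
  rw [hi] at h1
  rw [hm] at h2
  apply hne
  have : (reyeVec p i * reyeVec (1, l.2) m : ℂ) = reyeVec p m * reyeVec (1, l.2) i := by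
    push_cast at h1 h2
    linear_combination -(reyeVec (1, l.2) m : ℂ) * h1 + (reyeVec (1, l.2) i : ℂ) * h2
  exact_mod_cast this

lemma map_reyeVecC_ne_zero {n : ℕ} {ψ : (Fin 4 → ℂ) →ₗ[ℂ] (Fin n → ℂ)} {x : Fin 4 → ℂ}
    (hx : Function.Injective fun i => x i ^ 2) (hψ : LinearMap.ker ψ ≤ Submodule.span ℂ {x})
    (p) : ψ (reyeVecC p) ≠ 0 := by
  have h : ∀ p, ∃ l, ¬ ReyeInc p l := by decide +kernel
  obtain ⟨l, hl⟩ := h p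
  intro h0
  rw [← map_reyeVecC_mem_iff hx hψ, h0] at hl
  exact hl (zero_mem _)

lemma finrank_map_reyeLine {n : ℕ} {ψ : (Fin 4 → ℂ) →ₗ[ℂ] (Fin n → ℂ)} {x : Fin 4 → ℂ}
    (hx : Function.Injective fun i => x i ^ 2) (hψ : LinearMap.ker ψ ≤ Submodule.span ℂ {x})
    (l) : Module.finrank ℂ ((reyeLine l).map ψ) = 2 := by
  have hli : LinearIndependent ℂ ![ψ (reyeVecC (0, l.1)), ψ (reyeVecC (1, l.2))] := by
    rw [LinearIndependent.pair_iff]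
    intro s t hst
    have ht : t = 0 := by
      by_contra ht
      -- otherwise the second point of `l` is on all lines through the first point
      have h : ∀ l : Fin 4 × Fin 4, ∃ v, ¬ ReyeInc (1, l.2) (l.1, v) := by decide +kernel
      obtain ⟨v, hv⟩ := h l
      rw [← map_reyeVecC_mem_iff hx hψ] at hv
      apply hv
      have : ψ (reyeVecC (1, l.2)) = ψ ((-(t⁻¹ * s)) • reyeVecC (0, l.1)) := by
        have h1 : t • ψ (reyeVecC (1, l.2)) = -(s • ψ (reyeVecC (0, l.1))) :=
          eq_neg_of_add_eq_zero_right hst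
        rw [map_smul, neg_smul, mul_smul, ← smul_neg, ← h1, inv_smul_smul₀ ht]
      rw [this]
      exact Submodule.mem_map_of_mem (Submodule.smul_mem _ _
        (Submodule.subset_span (Set.mem_insert _ _)))
    rw [ht, zero_smul, add_zero] at hst
    exact ⟨(smul_eq_zero.1 hst).resolve_right (map_reyeVecC_ne_zero hx hψ _), ht⟩
  have := finrank_span_eq_card hli
  rw [Matrix.range_cons, Matrix.range_cons, Matrix.range_empty, Set.union_empty,
    Set.singleton_union] at this
  rw [reyeLine, Submodule.map_span, Set.image_pair, this, Fintype.card_fin]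

lemma injective_natCast_sq : Function.Injective fun i : Fin 4 => ((i : ℕ) : ℂ) ^ 2 := by
  intro i j h
  have h' : (i : ℕ) ^ 2 = (j : ℕ) ^ 2 := by
    simp only at h
    exact_mod_cast h
  exact Fin.ext (Nat.pow_left_injective (by norm_num : (2 : ℕ) ≠ 0) h')

lemma span_pair_eq_of_le {V : Type*} [AddCommGroup V] [Module ℂ V] {a b : V} {S : Submodule ℂ V}
    (ha : a ∈ S) (hb : b ∈ S) {c d : V} (hS : S = Submodule.span ℂ {c, d})
    (hc : c ∈ Submodule.span ℂ {a, b}) (hd : d ∈ Submodule.span ℂ {a, b}) :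
    Submodule.span ℂ {a, b} = S := by
  refine le_antisymm (Submodule.span_le.2 ?_) (hS ▸ Submodule.span_le.2 ?_)
  · rintro _ (rfl | rfl) <;> assumption
  · rintro _ (rfl | rfl) <;> assumption

/-- Every cube vertex together with a vertex of the tetrahedron spans a line of the cube
configuration. -/
lemma exists_tetrahedronVertex_sup_eq (i : Fin 4) (s) : ∃ l,
    tetrahedronVertex i ⊔ Submodule.span ℂ {cubeVertex s} = reyeLine l := by
  obtain ⟨k, v, h⟩ := exists_cubeVertex_eq s
  have h2 : ∀ (k : Fin 2) (i v : Fin 4), ∃ w, ReyeInc (k.succ, v) (i, w) ∧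
      ∃ t ∈ ({-2, 0, 2} : Finset ℤ), ∃ u ∈ ({1, -1} : Finset ℤ),
        ∀ j, reyeVec (1, w) j = t * reyeVec (0, i) j + u * reyeVec (k.succ, v) j := by
    decide +kernel
  obtain ⟨w, hw, t, -, u, -, htu⟩ := h2 k i v
  refine ⟨(i, w), ?_⟩
  rw [tetrahedronVertex, ← Submodule.span_union, Set.singleton_union, ← reyeVecC_zero, h]
  refine span_pair_eq_of_le (Submodule.subset_span (Set.mem_insert _ _))
    (reyeVecC_mem_reyeLine hw) rfl (Submodule.subset_span (Set.mem_insert _ _)) ?_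
  rw [Submodule.mem_span_pair]
  exact ⟨t, u, funext fun j => by simp [reyeVecC, htu]⟩

lemma exists_reyeLine_eq (l) : ∃ s,
    reyeLine l = tetrahedronVertex l.1 ⊔ Submodule.span ℂ {cubeVertex s} := by
  obtain ⟨s, hs⟩ := exists_eq_cubeVertex 0 l.2
  refine ⟨s, ?_⟩
  rw [tetrahedronVertex, ← Submodule.span_union, Set.singleton_union, ← reyeVecC_zero, ← hs]
  rfl

lemma span_cubeVertex_update (s : Fin 3 → ℤˣ) (i : Fin 3) :
    Submodule.span ℂ {cubeVertex s, cubeVertex (Function.update s i (-s i))} =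
      tetrahedronVertex i.succ ⊔ Submodule.span ℂ {cubeVertex s} := by
  have h : cubeVertex (Function.update s i (-s i)) =
      cubeVertex s - (2 * ((s i : ℤ) : ℂ)) • Pi.single i.succ 1 := by
    ext j
    refine Fin.cases ?_ (fun k => ?_) j
    · simp [cubeVertex, (Fin.succ_ne_zero i).symm]
    · by_cases hk : k = i
      · subst hk; simp [cubeVertex]; ring
      · simp [cubeVertex, hk]
  rw [tetrahedronVertex, ← Submodule.span_union, Set.singleton_union, h]
  have hs : ((s i : ℤ) : ℂ) * ((s i : ℤ) : ℂ) = 1 := by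
    exact_mod_cast Int.units_coe_mul_self (s i)
  refine span_pair_eq_of_le (Submodule.subset_span (by simp)) ?_ rfl ?_
    (Submodule.subset_span (Set.mem_insert _ _)) <;> rw [Submodule.mem_span_pair]
  · exact ⟨-(2 * ((s i : ℤ) : ℂ)), 1, by module⟩
  · refine ⟨(s i : ℤ) / 2, -((s i : ℤ) / 2), ?_⟩
    rw [smul_sub, neg_smul, neg_smul, smul_smul, sub_neg_eq_add]
    have : ((s i : ℤ) : ℂ) / 2 * (2 * ((s i : ℤ) : ℂ)) = 1 := by linear_combination hs
    rw [this]; module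

lemma span_cubeVertex_neg (s : Fin 3 → ℤˣ) :
    Submodule.span ℂ {cubeVertex s, cubeVertex (-s)} =
      tetrahedronVertex 0 ⊔ Submodule.span ℂ {cubeVertex s} := by
  have h : cubeVertex (-s) = (2 : ℂ) • Pi.single 0 1 - cubeVertex s := by
    ext j
    refine Fin.cases ?_ (fun k => ?_) j
    · simp [cubeVertex]; norm_num
    · simp [cubeVertex, Fin.succ_ne_zero]
  rw [tetrahedronVertex, ← Submodule.span_union, Set.singleton_union, h]
  refine span_pair_eq_of_le (Submodule.subset_span (by simp)) ?_ rfl ?_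
    (Submodule.subset_span (Set.mem_insert _ _)) <;> rw [Submodule.mem_span_pair]
  · exact ⟨2, -1, by module⟩
  · exact ⟨1 / 2, 1 / 2, by module⟩

lemma reyeCube_lines_eq_sup : reyeCube.lines =
    {l | ∃ i s, l = tetrahedronVertex i ⊔ Submodule.span ℂ {cubeVertex s}} := by
  ext l
  constructor
  · rintro (⟨s, i, rfl⟩ | ⟨s, rfl⟩)
    · exact ⟨_, s, span_cubeVertex_update s i⟩
    · exact ⟨_, s, span_cubeVertex_neg s⟩
  · rintro ⟨i, s, rfl⟩
    refine Fin.cases ?_ (fun k => ?_) i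
    · exact Or.inr ⟨s, (span_cubeVertex_neg s).symm⟩
    · exact Or.inl ⟨s, k, (span_cubeVertex_update s k).symm⟩

lemma reyeCube_lines : reyeCube.lines = Set.range reyeLine := by
  rw [reyeCube_lines_eq_sup]
  ext l
  constructor
  · rintro ⟨i, s, rfl⟩
    obtain ⟨l, hl⟩ := exists_tetrahedronVertex_sup_eq i s
    exact ⟨l, hl.symm⟩
  · rintro ⟨l, rfl⟩
    obtain ⟨s, hs⟩ := exists_reyeLine_eq l
    exact ⟨_, s, hs⟩

open Projectivization in
/-- The image of the cube configuration under a linear map whose kernel is at most one general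
point is labelled in the same way as the cube configuration. -/
theorem isLabelledBy_image_reyeCube {n : ℕ} {ψ : (Fin 4 → ℂ) →ₗ[ℂ] (Fin n → ℂ)} {x : Fin 4 → ℂ}
    (hx : Function.Injective fun i => x i ^ 2) (hψ : LinearMap.ker ψ ≤ Submodule.span ℂ {x}) :
    (reyeCube.image ψ).IsLabelledBy ReyeInc
      (fun p => mk ℂ (ψ (reyeVecC p)) (map_reyeVecC_ne_zero hx hψ p))
      (fun l => (reyeLine l).map ψ) where
  points_eq := by
    ext q
    simp only [PointLineSystem.image, reyeCube_points, Set.mem_ofPred_eq, Set.mem_range]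
    constructor
    · rintro ⟨r, ⟨p, hp⟩, hq⟩
      refine ⟨p, submodule_injective ?_⟩
      rw [hq, hp, submodule_mk, Submodule.map_span, Set.image_singleton]
    · rintro ⟨p, rfl⟩
      refine ⟨mk ℂ (reyeVecC p) (reyeVecC_ne_zero p), ⟨p, submodule_mk _ _⟩, ?_⟩
      rw [submodule_mk, submodule_mk, Submodule.map_span, Set.image_singleton]
  lines_eq := by
    ext q
    simp only [PointLineSystem.image, reyeCube_lines, Set.mem_ofPred_eq, Set.mem_range]
    constructor
    · rintro ⟨_, ⟨l, rfl⟩, rfl⟩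
      exact ⟨l, rfl⟩
    · rintro ⟨l, rfl⟩
      exact ⟨_, ⟨l, rfl⟩, rfl⟩
  finrank_line := finrank_map_reyeLine hx hψ
  incident_iff p l := by
    rw [submodule_mk, Submodule.span_singleton_le_iff_mem, map_reyeVecC_mem_iff hx hψ]

lemma isConfiguration_image_reyeCube {n : ℕ} {ψ : (Fin 4 → ℂ) →ₗ[ℂ] (Fin n → ℂ)}
    {x : Fin 4 → ℂ} (hx : Function.Injective fun i => x i ^ 2)
    (hψ : LinearMap.ker ψ ≤ Submodule.span ℂ {x}) :
    (reyeCube.image ψ).IsConfiguration 12 4 16 3 :=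
  (isLabelledBy_image_reyeCube hx hψ).isConfiguration (by simp) (by simp) ReyeInc.ncard_lines
    ReyeInc.ncard_points ReyeInc.point_ext ReyeInc.line_ext

lemma image_image {m n k : ℕ} {R : PointLineSystem m} {ψ : (Fin m → ℂ) →ₗ[ℂ] (Fin n → ℂ)}
    (hψ : Function.Injective ψ) (φ : (Fin n → ℂ) →ₗ[ℂ] (Fin k → ℂ)) :
    (R.image ψ).image φ = R.image (φ ∘ₗ ψ) := by
  ext q
  · constructor
    · rintro ⟨r, ⟨p, hp, hr⟩, hq⟩
      exact ⟨p, hp, by rw [hq, hr, Submodule.map_comp]⟩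
    · rintro ⟨p, hp, hq⟩
      refine ⟨Projectivization.map ψ hψ p, ⟨p, hp, ?_⟩, ?_⟩
      · induction p with | _ v hv
        rw [Projectivization.map_mk, Projectivization.submodule_mk, Projectivization.submodule_mk,
          Submodule.map_span, Set.image_singleton]
      · rw [hq]
        induction p with | _ v hv
        rw [Projectivization.map_mk, Projectivization.submodule_mk, Projectivization.submodule_mk,
          Submodule.map_span, Set.image_singleton, Submodule.map_span, Set.image_singleton]
        rfl
  · constructor
    · rintro ⟨r, ⟨p, hp, rfl⟩, rfl⟩
      exact ⟨p, hp, by rw [Submodule.map_comp]⟩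
    · rintro ⟨p, hp, rfl⟩
      exact ⟨_, ⟨p, hp, rfl⟩, by rw [Submodule.map_comp]⟩

/-! ### The configuration of a net of diagonal quadrics -/

/-- The diagonal linear map with the entries `d`. -/
def diagMap (d : Fin 4 → ℂ) : (Fin 4 → ℂ) →ₗ[ℂ] (Fin 4 → ℂ) :=
  LinearMap.pi fun i => d i • LinearMap.proj i

@[simp] lemma diagMap_apply (d v : Fin 4 → ℂ) (i : Fin 4) : diagMap d v i = d i * v i := rfl

lemma diagMap_injective {d : Fin 4 → ℂ} (hd : ∀ i, d i ≠ 0) : Function.Injective (diagMap d) :=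
  fun _ _ h => funext fun i => mul_left_cancel₀ (hd i) (congrFun h i)

/-- The `3 × 3` minor with the columns `i`, `j`, `k` of the matrix with rows `1`, `a`, `b`. -/
def netMinor (a b : Fin 4 → ℂ) (i j k : Fin 4) : ℂ :=
  a j * b k - a k * b j - a i * b k + a k * b i + a i * b j - a j * b i

/-- The squares of the coordinates of the base points of a general net are proportional to the
signed maximal minors of the coefficient matrix. -/
lemma NetIsGeneral.exists_solution {a b : Fin 4 → ℂ} (h : NetIsGeneral a b) :
    ∃ c : Fin 4 → ℂ, (∀ i, c i ≠ 0) ∧ ∀ y : Fin 4 → ℂ,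
      (∑ i, y i = 0 ∧ ∑ i, a i * y i = 0 ∧ ∑ i, b i * y i = 0) ↔ ∃ t : ℂ, y = t • c := by
  have h0 := h 0
  have h1 := h 1
  have h2 := h 2
  have h3 := h 3
  simp only [Matrix.det_fin_three, Matrix.submatrix_apply, Matrix.of_apply, id_eq,
    Matrix.cons_val_zero, Matrix.cons_val_one, Matrix.cons_val] at h0 h1 h2 h3
  simp only [show ((0 : Fin 4).succAbove 0) = 1 from rfl,
    show ((0 : Fin 4).succAbove 1) = 2 from rfl, show ((0 : Fin 4).succAbove 2) = 3 from rfl, show ((1 : Fin 4).succAbove 0) = 0 from rfl,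
    show ((1 : Fin 4).succAbove 1) = 2 from rfl, show ((1 : Fin 4).succAbove 2) = 3 from rfl,
    show ((2 : Fin 4).succAbove 0) = 0 from rfl, show ((2 : Fin 4).succAbove 1) = 1 from rfl,
    show ((2 : Fin 4).succAbove 2) = 3 from rfl, show ((3 : Fin 4).succAbove 0) = 0 from rfl,
    show ((3 : Fin 4).succAbove 1) = 1 from rfl, show ((3 : Fin 4).succAbove 2) = 2 from rfl]
    at h0 h1 h2 h3
  have hc0 : netMinor a b 1 2 3 ≠ 0 := fun hc => h0 (by
    unfold netMinor at hc; linear_combination hc)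
  refine ⟨![netMinor a b 1 2 3, -netMinor a b 0 2 3, netMinor a b 0 1 3, -netMinor a b 0 1 2],
    ?_, fun y => ⟨?_, ?_⟩⟩
  · intro i hc
    fin_cases i
    · exact hc0 hc
    · exact h1 (by simp [netMinor] at hc; linear_combination -hc)
    · exact h2 (by simp [netMinor] at hc; linear_combination hc)
    · exact h3 (by simp [netMinor] at hc; linear_combination -hc)
  · rintro ⟨e1, e2, e3⟩
    simp only [Fin.sum_univ_four] at e1 e2 e3
    refine ⟨y 0 / netMinor a b 1 2 3, funext fun i => ?_⟩
    fin_cases i <;> simp <;> field_simp <;> unfold netMinor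
    · linear_combination (a 2 * b 3 - a 3 * b 2) * e1 - (b 3 - b 2) * e2 + (a 3 - a 2) * e3
    · linear_combination -(a 1 * b 3 - a 3 * b 1) * e1 + (b 3 - b 1) * e2 - (a 3 - a 1) * e3
    · linear_combination (a 1 * b 2 - a 2 * b 1) * e1 - (b 2 - b 1) * e2 + (a 2 - a 1) * e3
  · rintro ⟨t, rfl⟩
    simp only [Fin.sum_univ_four, netMinor]
    refine ⟨?_, ?_, ?_⟩ <;> simp <;> ring

lemma map_diagMap_tetrahedronVertex {d : Fin 4 → ℂ} (hd : ∀ i, d i ≠ 0) (i : Fin 4) :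
    (tetrahedronVertex i).map (diagMap d) = tetrahedronVertex i := by
  have : diagMap d (Pi.single i 1) = d i • Pi.single i (1 : ℂ) := by
    ext j
    by_cases h : j = i
    · subst h; simp
    · simp [h]
  rw [tetrahedronVertex, Submodule.map_span, Set.image_singleton, this]
  exact Submodule.span_singleton_smul_eq (IsUnit.mk0 _ (hd i)) _

/-- The configuration of a general net of diagonal quadrics differs from the configuration of the
cube by a diagonal transformation. -/
theorem NetIsGeneral.exists_reyeNet_eq {a b : Fin 4 → ℂ} (h : NetIsGeneral a b) :
    ∃ d : Fin 4 → ℂ, (∀ i, d i ≠ 0) ∧ reyeNet a b = reyeCube.image (diagMap d) := by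
  obtain ⟨c, hc, hsol⟩ := h.exists_solution
  choose d hd2 using fun i => IsAlgClosed.exists_pow_nat_eq (c i) (zero_lt_two)
  have hd : ∀ i, d i ≠ 0 := fun i h0 => hc i (by rw [← hd2, h0]; simp)
  have hbase : ∀ p : ℙ ℂ (Fin 4 → ℂ), p ∈ netBasePoints a b ↔
      ∃ s, p.submodule = (Submodule.span ℂ {cubeVertex s}).map (diagMap d) := by
    intro p
    have h1 : p ∈ netBasePoints a b ↔ ∃ t : ℂ, (fun i => p.rep i ^ 2) = t • c :=
      hsol fun i => p.rep i ^ 2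
    rw [h1, p.submodule_eq]
    constructor
    · rintro ⟨t, ht⟩
      have ht' : ∀ i, p.rep i ^ 2 = t * c i := fun i => congrFun ht i
      have ht0 : t ≠ 0 := by
        rintro rfl
        exact p.rep_nonzero (funext fun i => by simpa using ht' i)
      -- normalize the first coordinate; the other coordinates are then determined up to sign
      have hp0 : p.rep 0 ≠ 0 := fun h0 => mul_ne_zero ht0 (hc 0) (by rw [← ht', h0]; simp)
      set r := p.rep 0 / d 0 with hr
      have hr0 : r ≠ 0 := div_ne_zero hp0 (hd 0)
      have hrt : r ^ 2 = t := by
        rw [hr, div_pow, ht', hd2]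
        exact mul_div_cancel_right₀ _ (hc 0)
      have hsign : ∀ i : Fin 3, ∃ s : ℤˣ, p.rep i.succ = r * (d i.succ * (s : ℤ)) := by
        intro i
        have : p.rep i.succ ^ 2 = (r * d i.succ) ^ 2 := by rw [ht', mul_pow, hrt, hd2]
        rcases sq_eq_sq_iff_eq_or_eq_neg.1 this with h | h
        · exact ⟨1, by simp [h]⟩
        · exact ⟨-1, by simp [h]⟩
      choose s hs using hsign
      refine ⟨s, ?_⟩
      have : p.rep = r • diagMap d (cubeVertex s) := by
        ext i
        refine Fin.cases ?_ (fun i => ?_) i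
        · simp [cubeVertex, hr, div_mul_cancel₀ _ (hd 0)]
        · simp [cubeVertex, hs]
      rw [Submodule.map_span, Set.image_singleton, this]
      exact Submodule.span_singleton_smul_eq (IsUnit.mk0 _ hr0) _
    · rintro ⟨s, hs⟩
      rw [Submodule.map_span, Set.image_singleton] at hs
      obtain ⟨r, hr⟩ :=
        Submodule.mem_span_singleton.1 (hs ▸ Submodule.mem_span_singleton_self p.rep)
      refine ⟨r ^ 2, funext fun i => ?_⟩
      have : cubeVertex s i ^ 2 = 1 := by
        refine Fin.cases ?_ (fun i => ?_) i
        · simp [cubeVertex]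
        · have := Int.units_coe_mul_self (s i)
          simp only [cubeVertex, Fin.cons_succ]
          rw [sq]
          exact_mod_cast this
      rw [← hr]
      simp only [Pi.smul_apply, diagMap_apply, smul_eq_mul, mul_pow, this, hd2]
      ring
  refine ⟨d, hd, ?_⟩
  ext q
  · constructor
    · rintro (hq | ⟨i, hi⟩)
      · obtain ⟨s, hs⟩ := (hbase q).1 hq
        have h0 : cubeVertex s ≠ 0 := fun h => one_ne_zero (α := ℂ) (congrFun h 0)
        exact ⟨Projectivization.mk ℂ _ h0, Or.inl ⟨s, Projectivization.submodule_mk _ _⟩,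
          by rw [hs, Projectivization.submodule_mk]⟩
      · have h0 : (Pi.single i 1 : Fin 4 → ℂ) ≠ 0 := fun h => one_ne_zero (α := ℂ)
          (by simpa using congrFun h i)
        exact ⟨Projectivization.mk ℂ _ h0, Or.inr ⟨i, Projectivization.submodule_mk _ _⟩,
          by rw [hi, Projectivization.submodule_mk]
             exact (map_diagMap_tetrahedronVertex hd i).symm⟩
    · rintro ⟨p, ⟨s, hs⟩ | ⟨i, hi⟩, hq⟩
      · exact Or.inl ((hbase q).2 ⟨s, by rw [hq, hs]⟩)
      · exact Or.inr ⟨i, by rw [hq, hi, map_diagMap_tetrahedronVertex hd]⟩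
  · rw [PointLineSystem.image, reyeCube_lines_eq_sup]
    constructor
    · rintro ⟨i, p, hp, rfl⟩
      obtain ⟨s, hs⟩ := (hbase p).1 hp
      exact ⟨_, ⟨i, s, rfl⟩, by rw [Submodule.map_sup, map_diagMap_tetrahedronVertex hd, hs]⟩
    · rintro ⟨_, ⟨i, s, rfl⟩, rfl⟩
      have h0 : diagMap d (cubeVertex s) ≠ 0 := fun h => hd 0 (by
        simpa [cubeVertex] using congrFun h 0)
      have h1 : (Projectivization.mk ℂ _ h0).submodule =
          (Submodule.span ℂ {cubeVertex s}).map (diagMap d) := by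
        rw [Projectivization.submodule_mk, Submodule.map_span, Set.image_singleton]
      exact ⟨i, Projectivization.mk ℂ _ h0, (hbase _).2 ⟨s, h1⟩,
        by rw [Submodule.map_sup, map_diagMap_tetrahedronVertex hd, h1]⟩

lemma diagMap_one : diagMap 1 = LinearMap.id := by ext; simp

lemma image_id {n : ℕ} (R : PointLineSystem n) : R.image LinearMap.id = R := by
  ext q
  · constructor
    · rintro ⟨p, hp, hq⟩
      rw [Submodule.map_id] at hq
      exact Projectivization.submodule_injective hq ▸ hp
    · exact fun hq => ⟨q, hq, (Submodule.map_id _).symm⟩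
  · simp [PointLineSystem.image]

lemma IsReye.exists_eq_image {R : PointLineSystem 4} (h : IsReye R) :
    ∃ d : Fin 4 → ℂ, (∀ i, d i ≠ 0) ∧ R = reyeCube.image (diagMap d) := by
  rcases h with rfl | ⟨a, b, hab, rfl⟩
  · exact ⟨1, fun _ => one_ne_zero, by rw [diagMap_one, image_id]⟩
  · exact hab.exists_reyeNet_eq

/-! ### Polarization of plane cubics -/

open MvPolynomial

/-- The first polar `∑ wᵢ ∂ᵢF(u)`. It vanishes if and only if `w` lies on the tangent line of
`F = 0` at `u`. -/
def polar (F : MvPolynomial (Fin 3) ℂ) (u w : Fin 3 → ℂ) : ℂ :=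
  ∑ i, w i * eval u (pderiv i F)

/-- For a cubic form, `F (u + t w)` is a cubic polynomial in `t` whose coefficients of `t` and `t³`
are the polar and `F w`; their sum is the odd part at `t = 1`. Hence the polar is determined by the
values of the form, which makes its behaviour under linear maps plain. -/
lemma polar_eq {F : MvPolynomial (Fin 3) ℂ} (hF : F.IsHomogeneous 3) (u w : Fin 3 → ℂ) :
    polar F u w = (eval (u + w) F - eval (u - w) F) / 2 - eval w F := by
  have hmem : F ∈ homogeneousSubmodule (Fin 3) ℂ 3 := hF
  rw [homogeneousSubmodule_eq_finsupp_supported, AddMonoidAlgebra.supported_eq_span_single] at hmem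
  refine Submodule.span_induction ?_ ?_ (fun p q _ _ hp hq => ?_) (fun r p _ h => ?_) hmem
  · rintro _ ⟨m, hm, rfl⟩
    have hm : m 0 + m 1 + m 2 = 3 := by
      simpa [Finsupp.degree_eq_sum, Fin.sum_univ_three] using hm
    have h0 : m 0 ≤ 3 := by omega
    have h1 : m 1 ≤ 3 := by omega
    have h2 : m 2 = 3 - m 0 - m 1 := by omega
    simp only [single_eq_monomial, polar, Fin.sum_univ_three, pderiv_monomial, eval_monomial,
      Finsupp.prod_pow, Fin.prod_univ_three, Finsupp.coe_tsub, Pi.sub_apply, Pi.add_apply,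
      Finsupp.single_apply, h2]
    generalize m 0 = k0 at *
    generalize m 1 = k1 at *
    interval_cases k0 <;> interval_cases k1 <;> first | omega | (simp; ring)
  · simp [polar]
  · simp only [polar, map_add, mul_add, Finset.sum_add_distrib] at *
    rw [hp, hq]; ring
  · have : polar (r • p) u w = r * polar p u w := by
      simp [polar, Finset.mul_sum, mul_left_comm]
    rw [this, h]
    simp only [smul_eval]
    ring

lemma eval_smul_of_isHomogeneous {F : MvPolynomial (Fin 3) ℂ} {n : ℕ} (hF : F.IsHomogeneous n)
    (t : ℂ) (u : Fin 3 → ℂ) : eval (t • u) F = t ^ n * eval u F := by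
  have hmem : F ∈ homogeneousSubmodule (Fin 3) ℂ n := hF
  rw [homogeneousSubmodule_eq_finsupp_supported, AddMonoidAlgebra.supported_eq_span_single] at hmem
  refine Submodule.span_induction ?_ ?_ (fun p q _ _ hp hq => ?_) (fun r p _ h => ?_) hmem
  · rintro _ ⟨m, hm, rfl⟩
    have hm : m 0 + m 1 + m 2 = n := by
      simpa [Finsupp.degree_eq_sum, Fin.sum_univ_three] using hm
    simp only [single_eq_monomial, eval_monomial, Finsupp.prod_pow, Fin.prod_univ_three]
    simp only [Pi.smul_apply, smul_eq_mul, mul_pow, ← hm, pow_add]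
    ring
  · simp
  · rw [map_add, map_add, hp, hq]; ring
  · rw [smul_eval, smul_eval, h]; ring

/-- The ten coefficients of a ternary cubic form. -/
lemma exists_cubic_coeffs {F : MvPolynomial (Fin 3) ℂ} (hF : F.IsHomogeneous 3) :
    ∃ k : Fin 10 → ℂ, ∀ u, eval u F =
      k 0 * u 0 ^ 3 + k 1 * u 0 ^ 2 * u 1 + k 2 * u 0 * u 1 ^ 2 + k 3 * u 1 ^ 3 +
      k 4 * u 0 ^ 2 * u 2 + k 5 * u 0 * u 1 * u 2 + k 6 * u 1 ^ 2 * u 2 +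
      k 7 * u 0 * u 2 ^ 2 + k 8 * u 1 * u 2 ^ 2 + k 9 * u 2 ^ 3 := by
  have hmem : F ∈ homogeneousSubmodule (Fin 3) ℂ 3 := hF
  rw [homogeneousSubmodule_eq_finsupp_supported, AddMonoidAlgebra.supported_eq_span_single] at hmem
  refine Submodule.span_induction ?_ ?_ (fun p q _ _ hp hq => ?_) (fun r p _ h => ?_) hmem
  · rintro _ ⟨m, hm, rfl⟩
    have hm : m 0 + m 1 + m 2 = 3 := by
      simpa [Finsupp.degree_eq_sum, Fin.sum_univ_three] using hm
    have h0 : m 0 ≤ 3 := by omega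
    have h1 : m 1 ≤ 3 := by omega
    have h2 : m 2 = 3 - m 0 - m 1 := by omega
    simp only [single_eq_monomial, eval_monomial, Finsupp.prod_pow, Fin.prod_univ_three, h2]
    generalize m 0 = k0 at *
    generalize m 1 = k1 at *
    have hk : k0 + k1 ≤ 3 := by omega
    -- the position of the monomial in the list of coefficients
    obtain ⟨j, hj⟩ : ∃ j : Fin 10, (k0, k1) =
        (![(3, 0), (2, 1), (1, 2), (0, 3), (2, 0), (1, 1), (0, 2), (1, 0), (0, 1), (0, 0)] :
          Fin 10 → ℕ × ℕ) j := by
      clear hm h2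
      interval_cases k0 <;> interval_cases k1 <;> first | omega | decide
    refine ⟨Pi.single j 1, fun u => ?_⟩
    fin_cases j <;> simp at hj <;> obtain ⟨rfl, rfl⟩ := hj <;> simp
  · exact ⟨0, by simp⟩
  · obtain ⟨k, hk⟩ := hp
    obtain ⟨l, hl⟩ := hq
    exact ⟨k + l, fun u => by rw [map_add, hk, hl]; simp only [Pi.add_apply]; ring⟩
  · obtain ⟨k, hk⟩ := h
    exact ⟨r • k, fun u => by rw [smul_eval, hk]; simp only [Pi.smul_apply, smul_eq_mul]; ring⟩

open Projectivization

variable {F : MvPolynomial (Fin 3) ℂ}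

lemma polar_smul_left (hF : F.IsHomogeneous 3) (t : ℂ) (u w : Fin 3 → ℂ) :
    polar F (t • u) w = t ^ 2 * polar F u w := by
  have h : ∀ i, (pderiv i F).IsHomogeneous 2 := fun i => hF.pderiv
  simp only [polar, eval_smul_of_isHomogeneous (h _), Finset.mul_sum]
  exact Finset.sum_congr rfl fun i _ => by ring

lemma mk_mem_planeCurve (hF : F.IsHomogeneous 3) {u : Fin 3 → ℂ} (hu : u ≠ 0) :
    mk ℂ u hu ∈ planeCurve F ↔ eval u F = 0 := by
  obtain ⟨t, ht⟩ := exists_smul_eq_mk_rep ℂ u hu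
  rw [planeCurve, Set.mem_ofPred_eq, ← ht, Units.smul_def, eval_smul_of_isHomogeneous hF]
  simp

lemma mem_tangentLine (hF : F.IsHomogeneous 3) {u : Fin 3 → ℂ} (hu : u ≠ 0) (w : Fin 3 → ℂ) :
    w ∈ tangentLine F (mk ℂ u hu) ↔ polar F u w = 0 := by
  obtain ⟨t, ht⟩ := exists_smul_eq_mk_rep ℂ u hu
  have : w ∈ tangentLine F (mk ℂ u hu) ↔ polar F (t • u) w = 0 := by
    rw [tangentLine, LinearMap.mem_ker, ht, polar]
    simp [mul_comm]
  rw [this, Units.smul_def, polar_smul_left hF]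
  simp

lemma mk_mem_contactPoints (hF : F.IsHomogeneous 3) {u w : Fin 3 → ℂ} (hu : u ≠ 0) (hw : w ≠ 0)
    (hwF : eval w F = 0) : mk ℂ u hu ∈ contactPoints F (mk ℂ w hw) ↔
      eval u F = 0 ∧ polar F u w = 0 ∧ (mk ℂ u hu = mk ℂ w hw →
        ∀ (z : Fin 3 → ℂ) (hz : z ≠ 0), eval z F = 0 → polar F w z = 0 →
          mk ℂ z hz = mk ℂ w hw) := by
  rw [contactPoints, Set.mem_ofPred_eq, mk_mem_planeCurve hF, submodule_mk,
    Submodule.span_singleton_le_iff_mem, mem_tangentLine hF, IsInflectionPoint,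
    mk_mem_planeCurve hF]
  refine and_congr_right fun _ => and_congr_right fun _ => imp_congr_right fun _ => ?_
  constructor
  · rintro ⟨-, h⟩ z hz hzF hzw
    refine h _ ((mk_mem_planeCurve hF hz).2 hzF) ?_
    rwa [submodule_mk, Submodule.span_singleton_le_iff_mem, mem_tangentLine hF]
  · refine fun h => ⟨hwF, fun q => ?_⟩
    induction q with | _ z hz
    rw [mk_mem_planeCurve hF, submodule_mk, Submodule.span_singleton_le_iff_mem,
      mem_tangentLine hF]
    exact h z hz

lemma isNonsingularCubic_iff (hF : F.IsHomogeneous 3) : IsNonsingularCubic F ↔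
    ∀ u, u ≠ 0 → eval u F = 0 → ∃ w, polar F u w ≠ 0 := by
  have key : ∀ p : ℙ ℂ (Fin 3 → ℂ), (∃ i, eval p.rep (pderiv i F) ≠ 0) ↔
      ∃ w, polar F p.rep w ≠ 0 := by
    intro p
    constructor
    · rintro ⟨i, hi⟩
      exact ⟨Pi.single i 1, by simpa [polar, Pi.single_apply] using hi⟩
    · contrapose!
      intro h w
      simp [polar, h]
  constructor
  · intro h u hu huF
    obtain ⟨w, hw⟩ := (key _).1 (h.nonsingular (mk ℂ u hu) ((mk_mem_planeCurve hF hu).2 huF))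
    obtain ⟨t, ht⟩ := exists_smul_eq_mk_rep ℂ u hu
    rw [← ht, Units.smul_def, polar_smul_left hF] at hw
    exact ⟨w, right_ne_zero_of_mul hw⟩
  · exact fun h => ⟨hF, fun p hp => (key p).2 (h _ p.rep_nonzero hp)⟩

/-! ### Linear changes of coordinates -/

/-- The composition of a ternary form with a linear map. -/
def compLin (F : MvPolynomial (Fin 3) ℂ) (g : (Fin 3 → ℂ) →ₗ[ℂ] (Fin 3 → ℂ)) :
    MvPolynomial (Fin 3) ℂ :=
  bind₁ (fun i => ∑ j, C (g (Pi.single j 1) i) * X j) F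

lemma eval_compLin (F : MvPolynomial (Fin 3) ℂ) (g : (Fin 3 → ℂ) →ₗ[ℂ] (Fin 3 → ℂ))
    (u : Fin 3 → ℂ) : eval u (compLin F g) = eval (g u) F := by
  have : (fun i => eval u (∑ j, C (g (Pi.single j 1) i) * X j)) = g u := by
    ext i
    conv_rhs => rw [← Finset.univ_sum_single u, map_sum, Finset.sum_apply]
    refine (map_sum (eval u) _ _).trans (Finset.sum_congr rfl fun j _ => ?_)
    have h : Pi.single j (u j) = u j • (Pi.single j 1 : Fin 3 → ℂ) := by
      rw [← Pi.single_smul, smul_eq_mul, mul_one]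
    rw [h, map_smul]
    simp [mul_comm]
  rw [← this]
  exact eval₂Hom_bind₁ _ _ _ _

lemma isHomogeneous_compLin {n : ℕ} (hF : F.IsHomogeneous n)
    (g : (Fin 3 → ℂ) →ₗ[ℂ] (Fin 3 → ℂ)) : (compLin F g).IsHomogeneous n := by
  have := hF.aeval (R := ℂ) (fun i => ∑ j, C (g (Pi.single j 1) i) * X j) (n := 1)
    fun i => IsHomogeneous.sum _ _ _ fun j _ => isHomogeneous_C_mul_X _ _
  rwa [one_mul] at this

variable {H : MvPolynomial (Fin 3) ℂ} {g : (Fin 3 → ℂ) ≃ₗ[ℂ] (Fin 3 → ℂ)} {κ : ℂ}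

lemma polar_map (hF : F.IsHomogeneous 3) (hH : H.IsHomogeneous 3)
    (hg : ∀ u, eval (g u) F = κ * eval u H) (u w : Fin 3 → ℂ) :
    polar F (g u) (g w) = κ * polar H u w := by
  rw [polar_eq hF, polar_eq hH, ← map_add, ← map_sub, hg, hg, hg]
  ring

lemma mk_map_mem_contactPoints (hF : F.IsHomogeneous 3) (hH : H.IsHomogeneous 3) (hκ : κ ≠ 0)
    (hg : ∀ u, eval (g u) F = κ * eval u H) {w : Fin 3 → ℂ} (hw : w ≠ 0) (hwH : eval w H = 0)
    (A : ℙ ℂ (Fin 3 → ℂ)) :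
    Projectivization.map g.toLinearMap g.injective A ∈ contactPoints F
        (mk ℂ (g w) ((map_ne_zero_iff g g.injective).2 hw)) ↔ A ∈ contactPoints H (mk ℂ w hw) := by
  have hmk : ∀ (u v : Fin 3 → ℂ) (hu : u ≠ 0) (hv : v ≠ 0) (hu' : g u ≠ 0) (hv' : g v ≠ 0),
      mk ℂ (g u) hu' = mk ℂ (g v) hv' ↔ mk ℂ u hu = mk ℂ v hv := by
    intro u v hu hv hu' hv'
    exact (Projectivization.map_injective g.toLinearMap g.injective).eq_iff
      (a := mk ℂ u hu) (b := mk ℂ v hv)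
  induction A with | _ u hu
  rw [map_mk]
  simp only [LinearEquiv.coe_coe]
  rw [mk_mem_contactPoints hF _ _ (by rw [hg, hwH, mul_zero]), mk_mem_contactPoints hH _ _ hwH,
    hg, polar_map hF hH hg, hmk u w hu hw]
  simp only [mul_eq_zero, hκ, false_or]
  refine and_congr_right fun _ => and_congr_right fun _ => imp_congr_right fun _ => ?_
  constructor
  · intro h z hz hzH hzw
    rw [← hmk z w hz hw ((map_ne_zero_iff g g.injective).2 hz)]
    exact h (g z) _ (by rw [hg, hzH, mul_zero]) (by rw [polar_map hF hH hg, hzw, mul_zero])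
  · intro h z hz hzF hzw
    obtain ⟨z, rfl⟩ := g.surjective z
    rw [hg, mul_eq_zero, or_iff_right hκ] at hzF
    rw [polar_map hF hH hg, mul_eq_zero, or_iff_right hκ] at hzw
    have hz0 := (map_ne_zero_iff g g.injective).1 hz
    rw [hmk z w hz0 hw]
    exact h z hz0 hzF hzw

/-- The contact points of a cubic are transformed by a linear change of coordinates. -/
lemma contactPoints_map (hF : F.IsHomogeneous 3) (hH : H.IsHomogeneous 3) (hκ : κ ≠ 0)
    (hg : ∀ u, eval (g u) F = κ * eval u H) {w : Fin 3 → ℂ} (hw : w ≠ 0) (hwH : eval w H = 0) :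
    contactPoints F (mk ℂ (g w) ((map_ne_zero_iff g g.injective).2 hw)) =
      Projectivization.map g.toLinearMap g.injective '' contactPoints H (mk ℂ w hw) := by
  ext A
  constructor
  · intro hA
    induction A with | _ u hu
    obtain ⟨u, rfl⟩ := g.surjective u
    have hu0 := (map_ne_zero_iff g g.injective).1 hu
    exact ⟨mk ℂ u hu0, (mk_map_mem_contactPoints hF hH hκ hg hw hwH _).1 hA, rfl⟩
  · rintro ⟨A, hA, rfl⟩
    exact (mk_map_mem_contactPoints hF hH hκ hg hw hwH A).2 hA

/-! ### The normal form of a cubic with three collinear points -/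

/-- The cubic form `H` with
`X₀ H = (X₀ X₂ + x₀x₁x₂x₃ X₁²)² - ∏ᵢ (X₀ - xᵢ² X₁)`.
The line `X₁ = 0` meets the cubic in `[0 : 0 : 1]` and `[1 : 0 : ±1]`. -/
def normalCubic (x : Fin 4 → ℂ) : MvPolynomial (Fin 3) ℂ :=
  X 0 * X 2 ^ 2 + C (2 * (x 0 * x 1 * x 2 * x 3)) * (X 1 ^ 2 * X 2) - X 0 ^ 3 +
    C (x 0 ^ 2 + x 1 ^ 2 + x 2 ^ 2 + x 3 ^ 2) * (X 0 ^ 2 * X 1) -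
    C (x 0 ^ 2 * x 1 ^ 2 + x 0 ^ 2 * x 2 ^ 2 + x 0 ^ 2 * x 3 ^ 2 + x 1 ^ 2 * x 2 ^ 2 +
      x 1 ^ 2 * x 3 ^ 2 + x 2 ^ 2 * x 3 ^ 2) * (X 0 * X 1 ^ 2) +
    C (x 1 ^ 2 * x 2 ^ 2 * x 3 ^ 2 + x 0 ^ 2 * x 2 ^ 2 * x 3 ^ 2 + x 0 ^ 2 * x 1 ^ 2 * x 3 ^ 2 +
      x 0 ^ 2 * x 1 ^ 2 * x 2 ^ 2) * X 1 ^ 3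

lemma isHomogeneous_normalCubic (x : Fin 4 → ℂ) : (normalCubic x).IsHomogeneous 3 := by
  have hX : ∀ (i : Fin 3) (n : ℕ), (X i ^ n : MvPolynomial (Fin 3) ℂ).IsHomogeneous n :=
    fun i n => isHomogeneous_X_pow i n
  have h1 : ∀ i : Fin 3, (X i : MvPolynomial (Fin 3) ℂ).IsHomogeneous 1 := isHomogeneous_X ℂ
  exact ((((((h1 0).mul (hX 2 2)).add (((hX 1 2).mul (h1 2)).C_mul _)).sub (hX 0 3)).add
    (((hX 0 2).mul (h1 1)).C_mul _)).sub (((h1 0).mul (hX 1 2)).C_mul _)).add ((hX 1 3).C_mul _)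

lemma eval_normalCubic (x : Fin 4 → ℂ) (u : Fin 3 → ℂ) : eval u (normalCubic x) =
    u 0 * u 2 ^ 2 + 2 * (x 0 * x 1 * x 2 * x 3) * (u 1 ^ 2 * u 2) - u 0 ^ 3 +
    (x 0 ^ 2 + x 1 ^ 2 + x 2 ^ 2 + x 3 ^ 2) * (u 0 ^ 2 * u 1) -
    (x 0 ^ 2 * x 1 ^ 2 + x 0 ^ 2 * x 2 ^ 2 + x 0 ^ 2 * x 3 ^ 2 + x 1 ^ 2 * x 2 ^ 2 +
      x 1 ^ 2 * x 3 ^ 2 + x 2 ^ 2 * x 3 ^ 2) * (u 0 * u 1 ^ 2) +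
    (x 1 ^ 2 * x 2 ^ 2 * x 3 ^ 2 + x 0 ^ 2 * x 2 ^ 2 * x 3 ^ 2 + x 0 ^ 2 * x 1 ^ 2 * x 3 ^ 2 +
      x 0 ^ 2 * x 1 ^ 2 * x 2 ^ 2) * u 1 ^ 3 := by
  simp [normalCubic]

lemma polar_normalCubic (x : Fin 4 → ℂ) (u w : Fin 3 → ℂ) : polar (normalCubic x) u w =
    w 0 * (u 2 ^ 2 - 3 * u 0 ^ 2 + 2 * (x 0 ^ 2 + x 1 ^ 2 + x 2 ^ 2 + x 3 ^ 2) * (u 0 * u 1) -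
      (x 0 ^ 2 * x 1 ^ 2 + x 0 ^ 2 * x 2 ^ 2 + x 0 ^ 2 * x 3 ^ 2 + x 1 ^ 2 * x 2 ^ 2 +
        x 1 ^ 2 * x 3 ^ 2 + x 2 ^ 2 * x 3 ^ 2) * u 1 ^ 2) +
    w 1 * (4 * (x 0 * x 1 * x 2 * x 3) * (u 1 * u 2) +
      (x 0 ^ 2 + x 1 ^ 2 + x 2 ^ 2 + x 3 ^ 2) * u 0 ^ 2 -
      2 * (x 0 ^ 2 * x 1 ^ 2 + x 0 ^ 2 * x 2 ^ 2 + x 0 ^ 2 * x 3 ^ 2 + x 1 ^ 2 * x 2 ^ 2 +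
        x 1 ^ 2 * x 3 ^ 2 + x 2 ^ 2 * x 3 ^ 2) * (u 0 * u 1) +
      3 * (x 1 ^ 2 * x 2 ^ 2 * x 3 ^ 2 + x 0 ^ 2 * x 2 ^ 2 * x 3 ^ 2 +
        x 0 ^ 2 * x 1 ^ 2 * x 3 ^ 2 + x 0 ^ 2 * x 1 ^ 2 * x 2 ^ 2) * u 1 ^ 2) +
    w 2 * (2 * (u 0 * u 2) + 2 * (x 0 * x 1 * x 2 * x 3) * u 1 ^ 2) := by
  rw [polar_eq (isHomogeneous_normalCubic x), eval_normalCubic, eval_normalCubic,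
    eval_normalCubic]
  simp only [Pi.add_apply, Pi.sub_apply]
  ring

variable {x : Fin 4 → ℂ}

lemma sub_sq_ne_zero (hx : Function.Injective fun i => x i ^ 2) {i j : Fin 4} (h : i ≠ j) :
    x i ^ 2 - x j ^ 2 ≠ 0 := fun h0 => h (hx (sub_eq_zero.1 h0))

/-- The product of the three coordinates of `x` other than the `i`-th. -/
def complProd (x : Fin 4 → ℂ) : Fin 4 → ℂ :=
  ![x 1 * x 2 * x 3, x 0 * x 2 * x 3, x 0 * x 1 * x 3, x 0 * x 1 * x 2]

lemma mul_complProd (x : Fin 4 → ℂ) (i : Fin 4) :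
    x i * complProd x i = x 0 * x 1 * x 2 * x 3 := by
  fin_cases i <;> simp [complProd] <;> ring

/-- The third elementary symmetric function of the `xᵢ²`, if one of them vanishes. -/
lemma esymm_three_eq_complProd_sq {i : Fin 4} (hi : x i = 0) :
    x 1 ^ 2 * x 2 ^ 2 * x 3 ^ 2 + x 0 ^ 2 * x 2 ^ 2 * x 3 ^ 2 + x 0 ^ 2 * x 1 ^ 2 * x 3 ^ 2 +
      x 0 ^ 2 * x 1 ^ 2 * x 2 ^ 2 = complProd x i ^ 2 := by
  fin_cases i <;> simp at hi <;> simp [complProd, hi] <;> ring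

lemma complProd_ne_zero (hx : Function.Injective fun i => x i ^ 2) {i : Fin 4} (hi : x i = 0) :
    complProd x i ≠ 0 := by
  have h : ∀ j, j ≠ i → x j ≠ 0 := fun j hj h0 => sub_sq_ne_zero hx hj (by rw [h0, hi, sub_self])
  fin_cases i <;> simp [complProd, h]

/-- A singular point of the cubic would give a multiple root of the binary quartic
`∏ᵢ (X₀ - xᵢ² X₁)`. -/
lemma isNonsingularCubic_normalCubic (hx : Function.Injective fun i => x i ^ 2) :
    IsNonsingularCubic (normalCubic x) := by
  rw [isNonsingularCubic_iff (isHomogeneous_normalCubic x)]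
  intro u hu huH
  by_contra! hsing
  have hX := hsing ![1, 0, 0]
  have hY := hsing ![0, 1, 0]
  have hZ := hsing ![0, 0, 1]
  simp only [polar_normalCubic] at hX hY hZ
  simp only [Matrix.cons_val_zero, Matrix.cons_val_one, Matrix.cons_val, zero_mul, one_mul,
    add_zero, zero_add] at hX hY hZ
  rw [eval_normalCubic] at huH
  set q : Fin 4 → ℂ := fun i => x i ^ 2 with hq
  -- the derivatives of the binary quartic vanish
  have hDX : (u 0 - q 1 * u 1) * (u 0 - q 2 * u 1) * (u 0 - q 3 * u 1) +
      (u 0 - q 0 * u 1) * (u 0 - q 2 * u 1) * (u 0 - q 3 * u 1) +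
      (u 0 - q 0 * u 1) * (u 0 - q 1 * u 1) * (u 0 - q 3 * u 1) +
      (u 0 - q 0 * u 1) * (u 0 - q 1 * u 1) * (u 0 - q 2 * u 1) = 0 := by
    simp only [hq]
    linear_combination u 2 * hZ - huH - u 0 * hX
  have hD : (u 0 - q 0 * u 1) * (u 0 - q 1 * u 1) * (u 0 - q 2 * u 1) * (u 0 - q 3 * u 1) = 0 := by
    simp only [hq]
    linear_combination (u 0 * u 2 + x 0 * x 1 * x 2 * x 3 * u 1 ^ 2) / 2 * hZ - u 0 * huH
  have hroot : ∃ i, u 0 = q i * u 1 := by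
    simp only [mul_eq_zero, sub_eq_zero] at hD
    rcases hD with ((h | h) | h) | h
    exacts [⟨0, h⟩, ⟨1, h⟩, ⟨2, h⟩, ⟨3, h⟩]
  have hne : ∀ i j, i ≠ j → q i - q j ≠ 0 := fun i j h => sub_sq_ne_zero hx h
  have hu1 : u 1 = 0 := by
    obtain ⟨i, hi⟩ := hroot
    rw [hi] at hDX
    have : ∀ j k l : Fin 4, i ≠ j → i ≠ k → i ≠ l →
        u 1 ^ 3 * ((q i - q j) * (q i - q k) * (q i - q l)) = 0 → u 1 = 0 := by
      intro j k l hj hk hl h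
      have := (mul_eq_zero.1 h).resolve_right
        (mul_ne_zero (mul_ne_zero (hne _ _ hj) (hne _ _ hk)) (hne _ _ hl))
      simpa using this
    fin_cases i
    · exact this 1 2 3 (by decide) (by decide) (by decide) (by
        simp only [Fin.zero_eta] at *; linear_combination hDX)
    · exact this 0 2 3 (by decide) (by decide) (by decide) (by
        simp only [Fin.mk_one] at *; linear_combination hDX)
    · exact this 0 1 3 (by decide) (by decide) (by decide) (by
        simp only [Fin.reduceFinMk] at *; linear_combination hDX)
    · exact this 0 1 2 (by decide) (by decide) (by decide) (by
        simp only [Fin.reduceFinMk] at *; linear_combination hDX)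
  have hu0 : u 0 = 0 := by
    obtain ⟨i, hi⟩ := hroot
    rw [hi, hu1, mul_zero]
  have hu2 : u 2 = 0 := by
    rw [hu0, hu1] at hX
    simpa using hX
  exact hu (funext fun i => by fin_cases i <;> assumption)

/-- The points of contact of the tangents from `[0 : 0 : 1]`. -/
def normalPoint (x : Fin 4 → ℂ) (i : Fin 4) : Fin 3 → ℂ := ![x i ^ 3, x i, -complProd x i]

lemma normalPoint_ne_zero (hx : Function.Injective fun i => x i ^ 2) (i : Fin 4) :
    normalPoint x i ≠ 0 := by
  intro h
  have h1 : x i = 0 := congrFun h 1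
  have h2 : -complProd x i = 0 := congrFun h 2
  exact complProd_ne_zero hx h1 (neg_eq_zero.1 h2)

lemma basisVector_ne_zero : (![0, 0, 1] : Fin 3 → ℂ) ≠ 0 := fun h => by
  simpa using congrFun h 2

/-- On a tangent from `[0 : 0 : 1]` the form `X₀ X₂ + x₀x₁x₂x₃ X₁²` vanishes at the point of
contact, which therefore projects to a root of the binary quartic. -/
lemma contactPoints_normalCubic (hx : Function.Injective fun i => x i ^ 2) :
    contactPoints (normalCubic x) (mk ℂ ![0, 0, 1] basisVector_ne_zero) =
      Set.range fun i => mk ℂ (normalPoint x i) (normalPoint_ne_zero hx i) := by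
  have hH := isHomogeneous_normalCubic x
  have h0 : eval ![0, 0, 1] (normalCubic x) = 0 := by simp [eval_normalCubic]
  ext A
  induction A with | _ u hu
  rw [mk_mem_contactPoints hH hu _ h0]
  constructor
  · rintro ⟨huH, hup, hinf⟩
    rw [eval_normalCubic] at huH
    simp only [polar_normalCubic, Matrix.cons_val_zero, Matrix.cons_val_one, Matrix.cons_val,
      zero_mul, one_mul, zero_add] at hup
    have hD : (u 0 - x 0 ^ 2 * u 1) * (u 0 - x 1 ^ 2 * u 1) * (u 0 - x 2 ^ 2 * u 1) *
        (u 0 - x 3 ^ 2 * u 1) = 0 := by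
      linear_combination (u 0 * u 2 + x 0 * x 1 * x 2 * x 3 * u 1 ^ 2) / 2 * hup - u 0 * huH
    obtain ⟨i, hi⟩ : ∃ i, u 0 = x i ^ 2 * u 1 := by
      simp only [mul_eq_zero, sub_eq_zero] at hD
      rcases hD with ((h | h) | h) | h
      exacts [⟨0, h⟩, ⟨1, h⟩, ⟨2, h⟩, ⟨3, h⟩]
    by_cases hu1 : u 1 = 0
    · -- the point is `[0 : 0 : 1]` itself
      have hu0 : u 0 = 0 := by rw [hi, hu1, mul_zero]
      have hu2 : u 2 ≠ 0 := fun hu2 => hu (funext fun i => by fin_cases i <;> assumption)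
      have hua : mk ℂ u hu = mk ℂ ![0, 0, 1] basisVector_ne_zero := by
        rw [mk_eq_mk_iff']
        exact ⟨u 2, funext fun i => by fin_cases i <;> simp [hu0, hu1]⟩
      have he : x 0 * x 1 * x 2 * x 3 = 0 := by
        by_contra he
        -- otherwise the tangent at `[0 : 0 : 1]` meets the cubic in one more point
        have hz : (![0, 2 * (x 0 * x 1 * x 2 * x 3), -(x 1 ^ 2 * x 2 ^ 2 * x 3 ^ 2 +
            x 0 ^ 2 * x 2 ^ 2 * x 3 ^ 2 + x 0 ^ 2 * x 1 ^ 2 * x 3 ^ 2 +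
            x 0 ^ 2 * x 1 ^ 2 * x 2 ^ 2)] : Fin 3 → ℂ) ≠ 0 := fun h => by
          have h1 : 2 * (x 0 * x 1 * x 2 * x 3) = 0 := congrFun h 1
          exact he ((mul_eq_zero.1 h1).resolve_left two_ne_zero)
        have := hinf hua _ hz (by rw [eval_normalCubic]; simp; ring)
          (by rw [polar_normalCubic]; simp)
        rw [mk_eq_mk_iff'] at this
        obtain ⟨t, ht⟩ := this
        have h1 := congrFun ht 1
        simp at h1
        simp [h1] at he
      obtain ⟨j, hj⟩ : ∃ j, x j = 0 := by
        simp only [mul_eq_zero] at he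
        rcases he with ((h | h) | h) | h
        exacts [⟨0, h⟩, ⟨1, h⟩, ⟨2, h⟩, ⟨3, h⟩]
      refine ⟨j, ?_⟩
      rw [hua, mk_eq_mk_iff']
      exact ⟨-complProd x j, funext fun i => by fin_cases i <;> simp [normalPoint, hj]⟩
    · refine ⟨i, ?_⟩
      have hxi : x i ≠ 0 := by
        intro hxi
        have he := mul_complProd x i
        rw [hxi, zero_mul] at he
        have hu0 : u 0 = 0 := by rw [hi, hxi]; simp
        rw [hu0, ← he, esymm_three_eq_complProd_sq hxi] at huH
        simp [hu1, complProd_ne_zero hx hxi] at huH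
      rw [eq_comm, mk_eq_mk_iff']
      refine ⟨u 1 / x i, funext fun j => ?_⟩
      have h2 : x i * (x i * u 2 + complProd x i * u 1) = 0 := by
        have h3 : u 1 * (x i * (x i * u 2 + complProd x i * u 1)) = 0 := by
          rw [← mul_complProd x i, hi] at hup
          linear_combination hup / 2
        exact (mul_eq_zero.1 h3).resolve_left hu1
      have h2 := (mul_eq_zero.1 h2).resolve_left hxi
      fin_cases j <;> simp [normalPoint]
      · rw [hi]; field_simp
      · field_simp
      · field_simp; linear_combination -h2
  · rintro ⟨i, hi⟩
    obtain ⟨t, rfl⟩ := (mk_eq_mk_iff' ℂ _ _ _ _).1 hi.symm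
    have ht : t ≠ 0 := by
      rintro rfl
      simp at hu
    refine ⟨?_, ?_, ?_⟩
    · rw [eval_smul_of_isHomogeneous hH, eval_normalCubic]
      fin_cases i <;> simp [normalPoint, complProd] <;> right <;> ring
    · rw [polar_smul_left hH, polar_normalCubic]
      fin_cases i <;> simp [normalPoint, complProd] <;> right <;> ring
    · intro h z hz hzH hzp
      obtain ⟨r, hr⟩ := (mk_eq_mk_iff' ℂ _ _ _ _).1 h
      have hxi : x i = 0 := by simpa [normalPoint, ht] using (congrFun hr 1).symm
      have hz0 : z 0 = 0 := by
        rw [polar_normalCubic] at hzp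
        simpa using hzp
      have he := mul_complProd x i
      rw [hxi, zero_mul] at he
      rw [eval_normalCubic, hz0, ← he, esymm_three_eq_complProd_sq hxi] at hzH
      have hz1 : z 1 = 0 := by simpa [complProd_ne_zero hx hxi] using hzH
      rw [mk_eq_mk_iff']
      exact ⟨z 2, funext fun j => by fin_cases j <;> simp [hz0, hz1]⟩

/-! ### The projection of the cube configuration -/

/-- The weights of Lagrange interpolation at `x₀²`, …, `x₃²`, up to a common factor. -/
def lagrangeWeight (x : Fin 4 → ℂ) : Fin 4 → ℂ :=
  ![(x 1 ^ 2 - x 2 ^ 2) * (x 1 ^ 2 - x 3 ^ 2) * (x 2 ^ 2 - x 3 ^ 2),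
    -((x 0 ^ 2 - x 2 ^ 2) * (x 0 ^ 2 - x 3 ^ 2) * (x 2 ^ 2 - x 3 ^ 2)),
    (x 0 ^ 2 - x 1 ^ 2) * (x 0 ^ 2 - x 3 ^ 2) * (x 1 ^ 2 - x 3 ^ 2),
    -((x 0 ^ 2 - x 1 ^ 2) * (x 0 ^ 2 - x 2 ^ 2) * (x 1 ^ 2 - x 2 ^ 2))]

/-- The projection from `x` which maps the vertices of the coordinate tetrahedron to the points of
contact of the tangents from `[0 : 0 : 1]` of the cubic `normalCubic x`. -/
def normalProj (x : Fin 4 → ℂ) : (Fin 4 → ℂ) →ₗ[ℂ] (Fin 3 → ℂ) :=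
  Fintype.linearCombination ℂ fun i => lagrangeWeight x i • normalPoint x i

lemma normalProj_apply (x y : Fin 4 → ℂ) :
    normalProj x y = ∑ i, y i • lagrangeWeight x i • normalPoint x i := rfl

lemma normalProj_self (x : Fin 4 → ℂ) : normalProj x x = 0 := by
  ext j
  rw [normalProj_apply, Fin.sum_univ_four]
  fin_cases j <;> simp [lagrangeWeight, normalPoint, complProd] <;> ring

lemma lagrangeWeight_ne_zero (hx : Function.Injective fun i => x i ^ 2) (i : Fin 4) :
    lagrangeWeight x i ≠ 0 := by
  have h : ∀ i j, i ≠ j → x i ^ 2 - x j ^ 2 ≠ 0 := fun i j h => sub_sq_ne_zero hx h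
  have h01 := h 0 1 (by decide)
  have h02 := h 0 2 (by decide)
  have h03 := h 0 3 (by decide)
  have h12 := h 1 2 (by decide)
  have h13 := h 1 3 (by decide)
  have h23 := h 2 3 (by decide)
  fin_cases i <;> simp [lagrangeWeight, *]

/-- A linear relation between the rows of the matrix of the projection is a quadratic polynomial
with the four roots `xᵢ²`. -/
lemma normalProj_surjective (hx : Function.Injective fun i => x i ^ 2) :
    Function.Surjective (normalProj x) := by
  rw [← LinearMap.dualMap_injective_iff, ← LinearMap.ker_eq_bot, LinearMap.ker_eq_bot']
  intro f hf
  have h1 : ∀ i, f (normalPoint x i) = 0 := by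
    intro i
    have := LinearMap.congr_fun hf (Pi.single i 1)
    rw [LinearMap.dualMap_apply, normalProj, Fintype.linearCombination_apply_single, one_smul,
      map_smul, LinearMap.zero_apply, smul_eq_mul, mul_eq_zero] at this
    exact this.resolve_left (lagrangeWeight_ne_zero hx i)
  have hf' : ∀ v : Fin 3 → ℂ, f v = v 0 * f (Pi.single 0 1) + v 1 * f (Pi.single 1 1) +
      v 2 * f (Pi.single 2 1) := by
    intro v
    conv_lhs => rw [← Finset.univ_sum_single v, map_sum, Fin.sum_univ_three]
    have h : ∀ j, Pi.single j (v j) = v j • (Pi.single j 1 : Fin 3 → ℂ) := fun j => by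
      rw [← Pi.single_smul, smul_eq_mul, mul_one]
    rw [h, h, h, map_smul, map_smul, map_smul]
    rfl
  set r := f (Pi.single 0 1)
  set s := f (Pi.single 1 1)
  set t := f (Pi.single 2 1)
  have h2 : ∀ i, x i ^ 3 * r + x i * s - complProd x i * t = 0 := by
    intro i
    have := h1 i
    rw [hf'] at this
    simp only [normalPoint, Matrix.cons_val_zero, Matrix.cons_val_one, Matrix.cons_val] at this
    linear_combination this
  have h3 : ∀ i, (x i ^ 2) ^ 2 * r + x i ^ 2 * s - x 0 * x 1 * x 2 * x 3 * t = 0 := by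
    intro i
    rw [← mul_complProd x i]
    linear_combination x i * h2 i
  have h01 : (x 0 ^ 2 + x 1 ^ 2) * r + s = 0 :=
    (mul_eq_zero.1 (by linear_combination h3 0 - h3 1 :
      (x 0 ^ 2 - x 1 ^ 2) * ((x 0 ^ 2 + x 1 ^ 2) * r + s) = 0)).resolve_left
      (sub_sq_ne_zero hx (by decide))
  have h02 : (x 0 ^ 2 + x 2 ^ 2) * r + s = 0 :=
    (mul_eq_zero.1 (by linear_combination h3 0 - h3 2 :
      (x 0 ^ 2 - x 2 ^ 2) * ((x 0 ^ 2 + x 2 ^ 2) * r + s) = 0)).resolve_left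
      (sub_sq_ne_zero hx (by decide))
  have hr : r = 0 :=
    (mul_eq_zero.1 (by linear_combination h01 - h02 :
      (x 1 ^ 2 - x 2 ^ 2) * r = 0)).resolve_left (sub_sq_ne_zero hx (by decide))
  have hs : s = 0 := by rw [hr] at h01; simpa using h01
  have ht : t = 0 := by
    by_contra ht
    -- all `complProd x i` vanish, hence at least two coordinates of `x` vanish
    have h4 : ∀ i, complProd x i = 0 := fun i => by
      have := h2 i
      rw [hr, hs] at this
      simpa [ht] using this
    have h5 : x 0 * x 1 * x 2 * x 3 = 0 := by rw [← mul_complProd x 0, h4, mul_zero]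
    simp only [mul_eq_zero] at h5
    rcases h5 with ((h | h) | h) | h <;> exact complProd_ne_zero hx h (h4 _)
  ext j
  rw [LinearMap.comp_apply, hf', hr, hs, ht]
  simp

lemma ker_normalProj (hx : Function.Injective fun i => x i ^ 2) :
    LinearMap.ker (normalProj x) = Submodule.span ℂ {x} := by
  have hx0 : x ≠ 0 := by
    rintro rfl
    exact sub_sq_ne_zero hx (i := 0) (j := 1) (by decide) (by simp)
  symm
  apply Submodule.eq_of_le_of_finrank_eq
  · rw [Submodule.span_singleton_le_iff_mem]
    exact normalProj_self x
  · have h := LinearMap.finrank_range_add_finrank_ker (normalProj x)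
    rw [LinearMap.range_eq_top.2 (normalProj_surjective hx), finrank_top] at h
    simp only [Module.finrank_fintype_fun_eq_card, Fintype.card_fin] at h
    rw [finrank_span_singleton hx0]
    omega

/-- The image `[-σ₃ : σ₁ : ± (σ₁σ₂ - σ₃)]` of a vertex of the cube, where the `σ`s are the
elementary symmetric functions of `u`. -/
def vertexImage (u : Fin 4 → ℂ) (ε : ℂ) : Fin 3 → ℂ :=
  ![-(u 1 * u 2 * u 3 + u 0 * u 2 * u 3 + u 0 * u 1 * u 3 + u 0 * u 1 * u 2),
    u 0 + u 1 + u 2 + u 3,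
    ε * ((u 0 + u 1 + u 2 + u 3) * (u 0 * u 1 + u 0 * u 2 + u 0 * u 3 + u 1 * u 2 + u 1 * u 3 +
      u 2 * u 3) - (u 1 * u 2 * u 3 + u 0 * u 2 * u 3 + u 0 * u 1 * u 3 + u 0 * u 1 * u 2))]

/-- The Vandermonde product of `u`. -/
def vandermonde (u : Fin 4 → ℂ) : ℂ :=
  (u 0 - u 1) * (u 0 - u 2) * (u 0 - u 3) * (u 1 - u 2) * (u 1 - u 3) * (u 2 - u 3)

lemma normalProj_even (x : Fin 4 → ℂ) (v : Fin 4) : ∃ u : Fin 4 → ℂ, (∀ i, u i ^ 2 = x i ^ 2) ∧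
    x 0 * x 1 * x 2 * x 3 = 1 * (u 0 * u 1 * u 2 * u 3) ∧
    normalProj x (reyeVecC (1, v)) = vandermonde u • vertexImage u 1 := by
  have h : ∀ v i, reyeVec (1, v) i ^ 2 = 1 := by decide +kernel
  refine ⟨fun i => reyeVecC (1, v) i * x i, fun i => ?_, ?_, ?_⟩
  · have := h v i
    rw [mul_pow, reyeVecC, ← Int.cast_pow, this, Int.cast_one, one_mul]
  · fin_cases v <;> simp [reyeVecC, reyeVec]
  · rw [normalProj_apply, Fin.sum_univ_four]
    ext j
    fin_cases v <;> fin_cases j <;>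
      simp [reyeVecC, reyeVec, lagrangeWeight, normalPoint, complProd, vandermonde,
        vertexImage] <;> ring

lemma normalProj_odd (x : Fin 4 → ℂ) (v : Fin 4) : ∃ u : Fin 4 → ℂ, (∀ i, u i ^ 2 = x i ^ 2) ∧
    x 0 * x 1 * x 2 * x 3 = (-1) * (u 0 * u 1 * u 2 * u 3) ∧
    normalProj x (reyeVecC (2, v)) = vandermonde u • vertexImage u (-1) := by
  have h : ∀ v i, reyeVec (2, v) i ^ 2 = 1 := by decide +kernel
  refine ⟨fun i => reyeVecC (2, v) i * x i, fun i => ?_, ?_, ?_⟩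
  · have := h v i
    rw [mul_pow, reyeVecC, ← Int.cast_pow, this, Int.cast_one, one_mul]
  · fin_cases v <;> simp [reyeVecC, reyeVec]
  · rw [normalProj_apply, Fin.sum_univ_four]
    ext j
    fin_cases v <;> fin_cases j <;>
      simp [reyeVecC, reyeVec, lagrangeWeight, normalPoint, complProd, vandermonde,
        vertexImage] <;> ring

lemma linePoint_ne_zero (ε : ℂ) : (![1, 0, ε] : Fin 3 → ℂ) ≠ 0 := fun h => by
  simpa using congrFun h 0

/-- The images of the vertices of the cube are points of contact of tangents from
`[1 : 0 : ±1]`. -/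
lemma vertexImage_mem_contactPoints (hx : Function.Injective fun i => x i ^ 2) {u : Fin 4 → ℂ}
    (hu : ∀ i, u i ^ 2 = x i ^ 2) {ε : ℂ} (hε : ε ^ 2 = 1)
    (he : x 0 * x 1 * x 2 * x 3 = ε * (u 0 * u 1 * u 2 * u 3)) {t : ℂ} {P : Fin 3 → ℂ}
    (hP : P ≠ 0) (hPt : P = t • vertexImage u ε) :
    mk ℂ P hP ∈ contactPoints (normalCubic x) (mk ℂ ![1, 0, ε] (linePoint_ne_zero ε)) := by
  have hH := isHomogeneous_normalCubic x
  subst hPt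
  have ht : t ≠ 0 := by
    rintro rfl
    simp at hP
  rw [mk_mem_contactPoints hH hP (linePoint_ne_zero ε) (by simp [eval_normalCubic, hε]),
    eval_smul_of_isHomogeneous hH, polar_smul_left hH]
  let σ₁ := u 0 + u 1 + u 2 + u 3
  let σ₂ := u 0 * u 1 + u 0 * u 2 + u 0 * u 3 + u 1 * u 2 + u 1 * u 3 + u 2 * u 3
  let σ₃ := u 1 * u 2 * u 3 + u 0 * u 2 * u 3 + u 0 * u 1 * u 3 + u 0 * u 1 * u 2
  let σ₄ := u 0 * u 1 * u 2 * u 3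
  refine ⟨mul_eq_zero_of_right _ ?_, mul_eq_zero_of_right _ ?_, ?_⟩
  · rw [eval_normalCubic, he]
    simp only [← hu, vertexImage, Matrix.cons_val_zero, Matrix.cons_val_one, Matrix.cons_val]
    linear_combination (-σ₃ * (σ₁ * σ₂ - σ₃) ^ 2 + 2 * σ₄ * σ₁ ^ 2 * (σ₁ * σ₂ - σ₃)) * hε
  · rw [polar_normalCubic, he]
    simp only [← hu, vertexImage, Matrix.cons_val_zero, Matrix.cons_val_one, Matrix.cons_val]
    linear_combination ((σ₁ * σ₂ - σ₃) ^ 2 - 2 * σ₃ * (σ₁ * σ₂ - σ₃) + 2 * σ₄ * σ₁ ^ 2) * hε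
  · intro h z hz hzH hzp
    obtain ⟨r, hr⟩ := (mk_eq_mk_iff' ℂ _ _ _ _).1 h
    -- the image is the point `[1 : 0 : ε]` itself if `σ₁ = 0`
    have h1 : u 0 + u 1 + u 2 + u 3 = 0 := by simpa [vertexImage, ht] using (congrFun hr 1).symm
    rw [polar_normalCubic] at hzp
    simp only [Matrix.cons_val_zero, Matrix.cons_val_one, Matrix.cons_val] at hzp
    rw [eval_normalCubic, he] at hzH
    simp only [← hu] at hzp hzH
    let E₁ := u 0 ^ 2 + u 1 ^ 2 + u 2 ^ 2 + u 3 ^ 2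
    have hL : 2 * ε * z 2 - (2 * z 0 - E₁ * z 1) = 0 := by
      linear_combination hzp - z 0 * hε
    have hz1 : z 1 ^ 3 * σ₃ ^ 2 = 0 := by
      linear_combination hzH - z 0 * (2 * ε * z 2 + (2 * z 0 - E₁ * z 1)) / 4 * hL -
        σ₄ * z 1 ^ 2 * hL + z 0 * z 2 ^ 2 * hε -
        (z 0 * z 1 ^ 2 * (σ₁ ^ 3 - 4 * σ₁ * σ₂ + 8 * σ₃) / 4 - z 1 ^ 3 * σ₄ * σ₁) * h1
    have hσ₃ : σ₃ ≠ 0 := by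
      have hne : ∀ i j, i ≠ j → u i + u j ≠ 0 := fun i j hij h0 => sub_sq_ne_zero hx hij (by
        rw [← hu, ← hu]; linear_combination (u i - u j) * h0)
      intro h0
      have : (u 0 + u 1) * (u 0 + u 2) * (u 0 + u 3) = 0 := by
        linear_combination u 0 ^ 2 * h1 + h0
      simp [hne] at this
    have hz1 : z 1 = 0 := by simpa [hσ₃] using hz1
    have hz2 : z 2 = ε * z 0 := by
      rw [hz1] at hL
      linear_combination ε / 2 * hL - z 2 * hε
    rw [mk_eq_mk_iff']
    exact ⟨z 0, funext fun i => by fin_cases i <;> simp [hz1, hz2, mul_comm]⟩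

/-! ### Reduction to the normal form -/

lemma isNonsingularCubic_map {H : MvPolynomial (Fin 3) ℂ} {g : (Fin 3 → ℂ) ≃ₗ[ℂ] (Fin 3 → ℂ)}
    {κ : ℂ} (hF : F.IsHomogeneous 3) (hH : H.IsHomogeneous 3) (hκ : κ ≠ 0)
    (hg : ∀ u, eval (g u) F = κ * eval u H) : IsNonsingularCubic F ↔ IsNonsingularCubic H := by
  rw [isNonsingularCubic_iff hF, isNonsingularCubic_iff hH]
  constructor
  · intro h u hu huH
    obtain ⟨w, hw⟩ := h (g u) ((map_ne_zero_iff g g.injective).2 hu) (by rw [hg, huH, mul_zero])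
    obtain ⟨w, rfl⟩ := g.surjective w
    rw [polar_map hF hH hg] at hw
    exact ⟨w, right_ne_zero_of_mul hw⟩
  · intro h u hu huF
    obtain ⟨u, rfl⟩ := g.surjective u
    rw [hg, mul_eq_zero, or_iff_right hκ] at huF
    obtain ⟨w, hw⟩ := h u ((map_ne_zero_iff g g.injective).1 hu) huF
    exact ⟨g w, by rw [polar_map hF hH hg]; exact mul_ne_zero hκ hw⟩

lemma exists_quadratic_roots (A B : ℂ) : ∃ r s : ℂ, r + s = A ∧ r * s = B := by
  obtain ⟨r, hr⟩ := IsAlgClosed.exists_root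
    (Polynomial.X ^ 2 - Polynomial.C A * Polynomial.X + Polynomial.C B) (by
      have : (Polynomial.X ^ 2 - Polynomial.C A * Polynomial.X + Polynomial.C B).degree = 2 := by
        compute_degree!
      rw [this]; decide)
  simp at hr
  exact ⟨r, A - r, by ring, by linear_combination -hr⟩

lemma exists_cubic_roots (A B C : ℂ) : ∃ r s t : ℂ,
    r + s + t = A ∧ r * s + r * t + s * t = B ∧ r * s * t = C := by
  obtain ⟨r, hr⟩ := IsAlgClosed.exists_root (Polynomial.X ^ 3 - Polynomial.C A * Polynomial.X ^ 2 +
      Polynomial.C B * Polynomial.X - Polynomial.C C) (by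
      have : (Polynomial.X ^ 3 - Polynomial.C A * Polynomial.X ^ 2 +
          Polynomial.C B * Polynomial.X - Polynomial.C C).degree = 3 := by
        compute_degree!
      rw [this]; decide)
  simp at hr
  obtain ⟨s, t, h1, h2⟩ := exists_quadratic_roots (A - r) (B - r * (A - r))
  exact ⟨r, s, t, by linear_combination h1, by linear_combination r * h1 + h2,
    by linear_combination r * h2 + hr⟩

lemma exists_quartic_roots (A B C D : ℂ) : ∃ q : Fin 4 → ℂ,
    q 0 + q 1 + q 2 + q 3 = A ∧
    q 0 * q 1 + q 0 * q 2 + q 0 * q 3 + q 1 * q 2 + q 1 * q 3 + q 2 * q 3 = B ∧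
    q 1 * q 2 * q 3 + q 0 * q 2 * q 3 + q 0 * q 1 * q 3 + q 0 * q 1 * q 2 = C ∧
    q 0 * q 1 * q 2 * q 3 = D := by
  obtain ⟨r, hr⟩ := IsAlgClosed.exists_root (Polynomial.X ^ 4 - Polynomial.C A * Polynomial.X ^ 3 +
      Polynomial.C B * Polynomial.X ^ 2 - Polynomial.C C * Polynomial.X + Polynomial.C D) (by
      have : (Polynomial.X ^ 4 - Polynomial.C A * Polynomial.X ^ 3 +
          Polynomial.C B * Polynomial.X ^ 2 - Polynomial.C C * Polynomial.X +
          Polynomial.C D).degree = 4 := by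
        compute_degree!
      rw [this]; decide)
  simp at hr
  obtain ⟨s, t, u, h1, h2, h3⟩ := exists_cubic_roots (A - r) (B - r * (A - r))
    (C - r * (B - r * (A - r)))
  refine ⟨![r, s, t, u], ?_⟩
  simp only [Matrix.cons_val_zero, Matrix.cons_val_one, Matrix.cons_val]
  exact ⟨by linear_combination h1, by linear_combination r * h1 + h2,
    by linear_combination r * h2 + h3, by linear_combination r * h3 - hr⟩

/-- The quartic with the roots `xᵢ²` and the square root `x₀x₁x₂x₃` of its constant coefficient
can be prescribed. -/
lemma exists_normalCubic_coeffs (Q A B C : ℂ) : ∃ x : Fin 4 → ℂ, ∀ u : Fin 3 → ℂ,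
    eval u (normalCubic x) = u 0 * u 2 ^ 2 + Q * (u 1 ^ 2 * u 2) - u 0 ^ 3 +
      A * (u 0 ^ 2 * u 1) + B * (u 0 * u 1 ^ 2) + C * u 1 ^ 3 := by
  obtain ⟨q, h1, h2, h3, h4⟩ := exists_quartic_roots A (-B) C (Q ^ 2 / 4)
  choose y hy using fun i => IsAlgClosed.exists_pow_nat_eq (q i) (zero_lt_two)
  obtain ⟨x, hx, hxQ⟩ : ∃ x : Fin 4 → ℂ, (∀ i, x i ^ 2 = q i) ∧
      2 * (x 0 * x 1 * x 2 * x 3) = Q := by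
    have : (2 * (y 0 * y 1 * y 2 * y 3)) ^ 2 = Q ^ 2 := by
      rw [← hy, ← hy, ← hy, ← hy] at h4
      linear_combination 4 * h4
    rcases sq_eq_sq_iff_eq_or_eq_neg.1 this with h | h
    · exact ⟨y, hy, h⟩
    · -- the sign of the product is adjusted by the sign of one factor
      refine ⟨![-y 0, y 1, y 2, y 3], fun i => ?_, ?_⟩
      · rw [← hy]
        fin_cases i <;> simp
      · simp only [Matrix.cons_val_zero, Matrix.cons_val_one, Matrix.cons_val]
        linear_combination -h
  refine ⟨x, fun u => ?_⟩
  rw [eval_normalCubic, hxQ]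
  simp only [hx]
  linear_combination (u 0 ^ 2 * u 1) * h1 - (u 0 * u 1 ^ 2) * h2 + u 1 ^ 3 * h3

lemma polar_normalPoint (x : Fin 4 → ℂ) (i : Fin 4) (w : Fin 3 → ℂ) :
    polar (normalCubic x) (normalPoint x i) w = (w 1 * x i ^ 2 - w 0) *
      (![(x 0 ^ 2 - x 1 ^ 2) * (x 0 ^ 2 - x 2 ^ 2) * (x 0 ^ 2 - x 3 ^ 2),
        (x 1 ^ 2 - x 0 ^ 2) * (x 1 ^ 2 - x 2 ^ 2) * (x 1 ^ 2 - x 3 ^ 2),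
        (x 2 ^ 2 - x 0 ^ 2) * (x 2 ^ 2 - x 1 ^ 2) * (x 2 ^ 2 - x 3 ^ 2),
        (x 3 ^ 2 - x 0 ^ 2) * (x 3 ^ 2 - x 1 ^ 2) * (x 3 ^ 2 - x 2 ^ 2)] : Fin 4 → ℂ) i := by
  rw [polar_normalCubic]
  fin_cases i <;> simp [normalPoint, complProd] <;> ring

lemma eval_normalPoint (x : Fin 4 → ℂ) (i : Fin 4) :
    eval (normalPoint x i) (normalCubic x) = 0 := by
  rw [eval_normalCubic]
  fin_cases i <;> simp [normalPoint, complProd] <;> ring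

/-- A multiple root of the binary quartic gives a singular point of the cubic. -/
lemma injective_of_isNonsingularCubic {x : Fin 4 → ℂ} (h : IsNonsingularCubic (normalCubic x)) :
    Function.Injective fun i => x i ^ 2 := by
  rw [isNonsingularCubic_iff (isHomogeneous_normalCubic x)] at h
  intro i j hij
  by_contra hne
  simp only at hij
  by_cases hP : normalPoint x i = 0
  · have hxi : x i = 0 := congrFun hP 1
    have hc : complProd x i = 0 := neg_eq_zero.1 (congrFun hP 2)
    have he := mul_complProd x i
    rw [hxi, zero_mul] at he
    have hE := esymm_three_eq_complProd_sq hxi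
    rw [hc, zero_pow two_ne_zero] at hE
    obtain ⟨z, hz⟩ := IsAlgClosed.exists_pow_nat_eq (x 0 ^ 2 * x 1 ^ 2 + x 0 ^ 2 * x 2 ^ 2 +
      x 0 ^ 2 * x 3 ^ 2 + x 1 ^ 2 * x 2 ^ 2 + x 1 ^ 2 * x 3 ^ 2 + x 2 ^ 2 * x 3 ^ 2) (zero_lt_two)
    obtain ⟨w, hw⟩ := h ![0, 1, z] (fun h0 => by simpa using congrFun h0 1)
      (by rw [eval_normalCubic, hE, ← he]; simp)
    rw [polar_normalCubic, hE, ← he] at hw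
    simp [hz] at hw
  · obtain ⟨w, hw⟩ := h _ hP (eval_normalPoint x i)
    rw [polar_normalPoint] at hw
    apply hw
    apply mul_eq_zero_of_right
    fin_cases i <;> fin_cases j <;> simp at hne hij <;> simp [hij]

lemma exists_linearEquiv_apply {v₁ v₂ v₃ : Fin 3 → ℂ} (h13 : LinearIndependent ℂ ![v₁, v₃])
    (h2 : v₂ ∉ Submodule.span ℂ {v₁, v₃}) : ∃ g : (Fin 3 → ℂ) ≃ₗ[ℂ] (Fin 3 → ℂ),
      ∀ u, g u = u 0 • v₁ + u 1 • v₂ + u 2 • v₃ := by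
  have happ : ∀ u, Fintype.linearCombination ℂ ![v₁, v₂, v₃] u =
      u 0 • v₁ + u 1 • v₂ + u 2 • v₃ := by
    intro u
    simp [Fintype.linearCombination_apply, Fin.sum_univ_three]
  refine ⟨LinearEquiv.ofInjectiveEndo (Fintype.linearCombination ℂ ![v₁, v₂, v₃]) ?_, happ⟩
  rw [← LinearMap.ker_eq_bot, LinearMap.ker_eq_bot']
  intro u hu
  rw [happ] at hu
  have hu1 : u 1 = 0 := by
    by_contra h1
    apply h2
    rw [Submodule.mem_span_pair]
    refine ⟨-((u 1)⁻¹ * u 0), -((u 1)⁻¹ * u 2), ?_⟩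
    have : v₂ = (u 1)⁻¹ • (u 1 • v₂) := (inv_smul_smul₀ h1 _).symm
    rw [this, show u 1 • v₂ = -(u 0 • v₁) - u 2 • v₃ by
      rw [← sub_eq_zero, ← hu]; module]
    module
  rw [hu1, zero_smul, add_zero] at hu
  obtain ⟨h0, h2⟩ := LinearIndependent.pair_iff.1 h13 _ _ hu
  exact funext fun i => by fin_cases i <;> assumption

/-- A nonsingular cubic with the points `[0 : 0 : 1]` and `[1 : 0 : ±1]` does not contain the line
through these points. -/
lemma coeff_ne_zero_of_isNonsingularCubic (hF : IsNonsingularCubic F) {k : Fin 10 → ℂ}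
    (hk : ∀ u, eval u F =
      k 0 * u 0 ^ 3 + k 1 * u 0 ^ 2 * u 1 + k 2 * u 0 * u 1 ^ 2 + k 3 * u 1 ^ 3 +
      k 4 * u 0 ^ 2 * u 2 + k 5 * u 0 * u 1 * u 2 + k 6 * u 1 ^ 2 * u 2 +
      k 7 * u 0 * u 2 ^ 2 + k 8 * u 1 * u 2 ^ 2 + k 9 * u 2 ^ 3)
    (h9 : k 9 = 0) (h4 : k 4 = 0) (h0 : k 0 = -k 7) : k 7 ≠ 0 := by
  intro h7
  have hH := hF.isHomogeneous
  rw [isNonsingularCubic_iff hH] at hF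
  -- the residual conic meets the line in a singular point of the cubic
  obtain ⟨s, t, hst, hq⟩ : ∃ s t : ℂ, ¬ (s = 0 ∧ t = 0) ∧
      k 1 * s ^ 2 + k 5 * s * t + k 8 * t ^ 2 = 0 := by
    by_cases h1 : k 1 = 0
    · exact ⟨1, 0, by simp, by simp [h1]⟩
    · obtain ⟨r, r', h, h'⟩ := exists_quadratic_roots (-(k 5 / k 1)) (k 8 / k 1)
      refine ⟨r, 1, by simp, ?_⟩
      have e1 : k 5 = -(k 1 * (r + r')) := by rw [h]; field_simp
      have e2 : k 8 = k 1 * (r * r') := by rw [h']; field_simp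
      rw [e1, e2]; ring
  obtain ⟨w, hw⟩ := hF ![s, 0, t] (fun h => hst ⟨congrFun h 0, congrFun h 2⟩)
    (by rw [hk]; simp [h9, h4, h0, h7])
  apply hw
  rw [polar_eq hH, hk, hk, hk, h9, h4, h0, h7]
  simp
  linear_combination w 1 * hq

/-- Every datum of a Hesse–Salmon configuration is projectively equivalent to one in normal
form. -/
theorem exists_normalForm {a b c : ℙ ℂ (Fin 3 → ℂ)}
    (h : IsHesseSalmonDatum F a b c) : ∃ (g : (Fin 3 → ℂ) ≃ₗ[ℂ] (Fin 3 → ℂ)) (x : Fin 4 → ℂ)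
      (κ : ℂ), κ ≠ 0 ∧ (Function.Injective fun i => x i ^ 2) ∧
      (∀ u, eval (g u) F = κ * eval u (normalCubic x)) ∧
      a = mk ℂ (g ![0, 0, 1]) ((map_ne_zero_iff g g.injective).2 basisVector_ne_zero) ∧
      b = mk ℂ (g ![1, 0, 1]) ((map_ne_zero_iff g g.injective).2 (linePoint_ne_zero 1)) ∧
      c = mk ℂ (g ![1, 0, -1]) ((map_ne_zero_iff g g.injective).2 (linePoint_ne_zero (-1))) := by
  obtain ⟨l, hl, hal, hbl, hcl⟩ := h.collinear
  have hF := h.isNonsingularCubic.isHomogeneous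
  have hF0 := h.isNonsingularCubic
  have haF := h.mem_a
  have hbF := h.mem_b
  have hcF := h.mem_c
  have hab := h.ne_ab
  have hbc := h.ne_bc
  have hac := h.ne_ac
  clear h
  induction a with | _ a ha
  induction b with | _ b hb
  induction c with | _ c hc
  rw [mk_mem_planeCurve hF] at haF hbF hcF
  rw [submodule_mk, Submodule.span_singleton_le_iff_mem] at hal hbl hcl
  have hlin : LinearIndependent ℂ ![a, b] := by
    rw [LinearIndependent.pair_iff' ha]
    intro t ht
    exact hab ((mk_eq_mk_iff' ℂ _ _ _ _).2 ⟨t, ht⟩).symm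
  have hspan : Submodule.span ℂ {a, b} = l := by
    apply Submodule.eq_of_le_of_finrank_eq
    · rw [Submodule.span_le]
      rintro _ (rfl | rfl) <;> assumption
    · have := finrank_span_eq_card hlin
      rw [Matrix.range_cons, Matrix.range_cons, Matrix.range_empty, Set.union_empty,
        Set.singleton_union] at this
      rw [this, hl, Fintype.card_fin]
  rw [← hspan, Submodule.mem_span_pair] at hcl
  obtain ⟨r, s, rfl⟩ := hcl
  have hr : r ≠ 0 := by
    rintro rfl
    exact hbc ((mk_eq_mk_iff' ℂ _ _ _ _).2 ⟨s, by simp⟩).symm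
  have hs : s ≠ 0 := by
    rintro rfl
    exact hac ((mk_eq_mk_iff' ℂ _ _ _ _).2 ⟨r, by simp⟩).symm
  have hlin' := LinearIndependent.pair_iff.1 hlin
  set v₁ : Fin 3 → ℂ := s • b + (r / 2) • a with hv₁
  set v₃ : Fin 3 → ℂ := -(r / 2) • a with hv₃
  have h13 : LinearIndependent ℂ ![v₁, v₃] := by
    rw [LinearIndependent.pair_iff]
    intro p q hpq
    obtain ⟨h1, h2⟩ := hlin' ((p - q) * (r / 2)) (p * s) (by rw [← hpq, hv₁, hv₃]; module)
    have hp : p = 0 := (mul_eq_zero.1 h2).resolve_right hs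
    have hq : p - q = 0 := (mul_eq_zero.1 h1).resolve_right (div_ne_zero hr two_ne_zero)
    exact ⟨hp, by rw [hp] at hq; simpa using hq⟩
  obtain ⟨v₂, hv₂⟩ : ∃ v₂, v₂ ∉ Submodule.span ℂ {v₁, v₃} := by
    have h2 := finrank_span_eq_card h13
    rw [Matrix.range_cons, Matrix.range_cons, Matrix.range_empty, Set.union_empty,
      Set.singleton_union, Fintype.card_fin] at h2
    by_contra! hall
    rw [(Submodule.eq_top_iff').2 hall, finrank_top] at h2
    simp at h2
  obtain ⟨g, hg⟩ := exists_linearEquiv_apply h13 hv₂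
  have hH := isHomogeneous_compLin hF g.toLinearMap
  have hgH : ∀ u, eval (g u) F = 1 * eval u (compLin F g.toLinearMap) := fun u => by
    rw [eval_compLin, one_mul]; rfl
  have hH0 := (isNonsingularCubic_map hF hH one_ne_zero hgH).1 hF0
  obtain ⟨k, hk⟩ := exists_cubic_coeffs hH
  have hk' : ∀ u, eval (g u) F = _ := fun u => ((hgH u).trans (one_mul _)).trans (hk u)
  have ea : g ![0, 0, 1] = -(r / 2) • a := by rw [hg]; simp [hv₃]
  have eb : g ![1, 0, 1] = s • b := by rw [hg]; simp [hv₁, hv₃]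
  have ec : g ![1, 0, -1] = r • a + s • b := by
    rw [hg]; simp [hv₁, hv₃]; module
  have fa := hk' ![0, 0, 1]
  have fb := hk' ![1, 0, 1]
  have fc := hk' ![1, 0, -1]
  rw [ea, eval_smul_of_isHomogeneous hF, haF, mul_zero] at fa
  rw [eb, eval_smul_of_isHomogeneous hF, hbF, mul_zero] at fb
  rw [ec, hcF] at fc
  simp at fa fb fc
  have h9 : k 9 = 0 := fa.symm
  have h4 : k 4 = 0 := by linear_combination (fc - fb) / 2 - h9
  have h0 : k 0 = -k 7 := by linear_combination -(fc + fb) / 2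
  have h7 := coeff_ne_zero_of_isNonsingularCubic hH0 hk h9 h4 h0
  -- `v₂` is moved to the tangent at `a` and then along it, so that the coefficients of
  -- `X₁ X₂²` and of `X₀ X₁ X₂` vanish
  set α := k 8 / k 7 with hα
  set β := k 5 / (2 * k 7) with hβ
  have h8 : k 8 = α * k 7 := by rw [hα]; field_simp
  have h5 : k 5 = 2 * β * k 7 := by rw [hβ]; field_simp
  have hv₂' : v₂ - α • v₁ - β • v₃ ∉ Submodule.span ℂ {v₁, v₃} := by
    intro hmem
    apply hv₂
    have h1 : v₁ ∈ Submodule.span ℂ {v₁, v₃} := Submodule.subset_span (Set.mem_insert _ _)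
    have h3 : v₃ ∈ Submodule.span ℂ {v₁, v₃} := Submodule.subset_span (by simp)
    have := add_mem (add_mem hmem (Submodule.smul_mem _ α h1)) (Submodule.smul_mem _ β h3)
    convert this using 1
    module
  obtain ⟨g', hg'⟩ := exists_linearEquiv_apply h13 hv₂'
  have hgg' : ∀ u : Fin 3 → ℂ, g' u = g ![u 0 - α * u 1, u 1, u 2 - β * u 1] := by
    intro u
    rw [hg, hg']
    simp only [Matrix.cons_val_zero, Matrix.cons_val_one, Matrix.cons_val]
    module
  obtain ⟨x, hx⟩ := exists_normalCubic_coeffs ((k 6 - α * k 5) / k 7) (3 * α + k 1 / k 7)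
    (β ^ 2 - 3 * α ^ 2 + (-2 * α * k 1 + k 2 - k 5 * β) / k 7)
    (α ^ 3 + (k 1 * α ^ 2 - α * k 2 + k 3 + k 5 * α * β - k 6 * β) / k 7)
  have hmain : ∀ u, eval (g' u) F = k 7 * eval u (normalCubic x) := by
    intro u
    rw [hgg', hk', hx]
    simp only [Matrix.cons_val_zero, Matrix.cons_val_one, Matrix.cons_val]
    rw [h9, h4, h0, h8, h5]
    field_simp
    ring
  have hinj := injective_of_isNonsingularCubic
    ((isNonsingularCubic_map hF (isHomogeneous_normalCubic x) h7 hmain).1 hF0)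
  have ea' : g' ![0, 0, 1] = -(r / 2) • a := by rw [hgg', ← ea]; simp
  have eb' : g' ![1, 0, 1] = s • b := by rw [hgg', ← eb]; simp
  have ec' : g' ![1, 0, -1] = r • a + s • b := by rw [hgg', ← ec]; simp
  refine ⟨g', x, k 7, h7, hinj, hmain, ?_, ?_, ?_⟩ <;> rw [eq_comm, mk_eq_mk_iff']
  · exact ⟨_, ea'.symm⟩
  · exact ⟨_, eb'.symm⟩
  · exact ⟨1, by rw [one_smul, ec']⟩

/-! ### Hesse–Salmon configurations as projections of the cube configuration -/

variable {a b c : ℙ ℂ (Fin 3 → ℂ)}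

lemma IsHesseSalmonDatum.swap_left (h : IsHesseSalmonDatum F a b c) :
    IsHesseSalmonDatum F b a c where
  isNonsingularCubic := h.isNonsingularCubic
  mem_a := h.mem_b
  mem_b := h.mem_a
  mem_c := h.mem_c
  ne_ab := h.ne_ab.symm
  ne_bc := h.ne_ac
  ne_ac := h.ne_bc
  collinear := let ⟨l, hl, ha, hb, hc⟩ := h.collinear; ⟨l, hl, hb, ha, hc⟩

lemma IsHesseSalmonDatum.rotate (h : IsHesseSalmonDatum F a b c) :
    IsHesseSalmonDatum F c a b where
  isNonsingularCubic := h.isNonsingularCubic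
  mem_a := h.mem_c
  mem_b := h.mem_a
  mem_c := h.mem_b
  ne_ab := h.ne_ac.symm
  ne_bc := h.ne_ab
  ne_ac := h.ne_bc.symm
  collinear := let ⟨l, hl, ha, hb, hc⟩ := h.collinear; ⟨l, hl, hc, ha, hb⟩

lemma mk_normalPoint_injective {x : Fin 4 → ℂ} (hx : Function.Injective fun i => x i ^ 2) :
    Function.Injective fun i => mk ℂ (normalPoint x i) (normalPoint_ne_zero hx i) := by
  intro i j hij
  obtain ⟨t, ht⟩ := (mk_eq_mk_iff' ℂ _ _ _ _).1 hij
  have h0 : t * x j ^ 3 = x i ^ 3 := congrFun ht 0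
  have h1 : t * x j = x i := congrFun ht 1
  by_contra hne
  have hxi : x i = 0 := (mul_eq_zero.1 (by linear_combination h0 - x j ^ 2 * h1 :
    x i * (x j ^ 2 - x i ^ 2) = 0)).resolve_right (sub_sq_ne_zero hx (Ne.symm hne))
  have ht0 : t ≠ 0 := by
    rintro rfl
    exact normalPoint_ne_zero hx i (by rw [← ht, zero_smul])
  rw [hxi, mul_eq_zero, or_iff_right ht0] at h1
  exact sub_sq_ne_zero hx hne (by rw [hxi, h1, sub_self])

lemma IsHesseSalmonDatum.ncard_contactPoints (h : IsHesseSalmonDatum F a b c) :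
    (contactPoints F a).ncard = 4 := by
  obtain ⟨g, x, κ, hκ, hx, hg, ha, -, -⟩ := exists_normalForm h
  rw [ha, contactPoints_map h.isNonsingularCubic.isHomogeneous (isHomogeneous_normalCubic x) hκ hg
    basisVector_ne_zero (by simp [eval_normalCubic]),
    Set.ncard_image_of_injective _ (Projectivization.map_injective _ g.injective),
    contactPoints_normalCubic hx, ← Set.image_univ,
    Set.ncard_image_of_injective _ (mk_normalPoint_injective hx), Set.ncard_univ, Nat.card_fin]

lemma eq_range_of_ncard_eq {α : Type*} {n : ℕ} [NeZero n] {f : Fin n → α}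
    (hf : Function.Injective f) {S : Set α} (hS : S.ncard = n) (hfS : ∀ i, f i ∈ S) :
    S = Set.range f := by
  have hfin : S.Finite := Set.finite_of_ncard_ne_zero (hS ▸ NeZero.ne n)
  refine (Set.eq_of_subset_of_ncard_le (Set.range_subset_iff.2 hfS) ?_ hfin).symm
  rw [hS, ← Set.image_univ, Set.ncard_image_of_injective _ hf, Set.ncard_univ, Nat.card_fin]

/-- The projection of the cube configuration from `x` is the Hesse–Salmon configuration of the
cubic in normal form. The images of the three tetrahedra consist of points of contact, and the
number of the latter shows that there are no others. -/
theorem hesseSalmon_eq_image (h : IsHesseSalmonDatum F a b c)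
    {g : (Fin 3 → ℂ) ≃ₗ[ℂ] (Fin 3 → ℂ)} {x : Fin 4 → ℂ} {κ : ℂ} (hκ : κ ≠ 0)
    (hx : Function.Injective fun i => x i ^ 2)
    (hg : ∀ u, eval (g u) F = κ * eval u (normalCubic x))
    (ha : a = mk ℂ (g ![0, 0, 1]) ((map_ne_zero_iff g g.injective).2 basisVector_ne_zero))
    (hb : b = mk ℂ (g ![1, 0, 1]) ((map_ne_zero_iff g g.injective).2 (linePoint_ne_zero 1)))
    (hc : c = mk ℂ (g ![1, 0, -1]) ((map_ne_zero_iff g g.injective).2 (linePoint_ne_zero (-1)))) :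
    hesseSalmon F a b c = reyeCube.image (g.toLinearMap ∘ₗ normalProj x) := by
  have hF := h.isNonsingularCubic.isHomogeneous
  have hH := isHomogeneous_normalCubic x
  have hker : LinearMap.ker (g.toLinearMap ∘ₗ normalProj x) ≤ Submodule.span ℂ {x} := by
    rw [LinearMap.ker_comp_of_ker_eq_bot _ (LinearMap.ker_eq_bot.2 g.injective),
      ker_normalProj hx]
  have hlab := isLabelledBy_image_reyeCube hx hker
  have hinj := hlab.pt_injective ReyeInc.point_ext
  have hne := map_reyeVecC_ne_zero hx (ker_normalProj hx).le
  have hpt : ∀ p, mk ℂ _ (map_reyeVecC_ne_zero hx hker p) =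
      Projectivization.map g.toLinearMap g.injective (mk ℂ (normalProj x (reyeVecC p)) (hne p)) :=
    fun p => rfl
  have hA : contactPoints F a =
      Set.range fun i => mk ℂ _ (map_reyeVecC_ne_zero hx hker (0, i)) := by
    refine eq_range_of_ncard_eq (fun i j hij => ?_) h.ncard_contactPoints fun i => ?_
    · simpa using hinj hij
    rw [hpt, ha, mk_map_mem_contactPoints hF hH hκ hg basisVector_ne_zero
      (by simp [eval_normalCubic]), contactPoints_normalCubic hx]
    refine ⟨i, ?_⟩
    rw [eq_comm, mk_eq_mk_iff']
    exact ⟨lagrangeWeight x i, by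
      rw [reyeVecC_zero, normalProj, Fintype.linearCombination_apply_single, one_smul]⟩
  have hB : contactPoints F b =
      Set.range fun i => mk ℂ _ (map_reyeVecC_ne_zero hx hker (1, i)) := by
    refine eq_range_of_ncard_eq (fun i j hij => ?_) h.swap_left.ncard_contactPoints fun i => ?_
    · simpa using hinj hij
    obtain ⟨u, hu, he, hi⟩ := normalProj_even x i
    rw [hpt, hb, mk_map_mem_contactPoints hF hH hκ hg (linePoint_ne_zero 1)
      (by simp [eval_normalCubic])]
    exact vertexImage_mem_contactPoints hx hu (by norm_num) he (hne _) hi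
  have hC : contactPoints F c =
      Set.range fun i => mk ℂ _ (map_reyeVecC_ne_zero hx hker (2, i)) := by
    refine eq_range_of_ncard_eq (fun i j hij => ?_) h.rotate.ncard_contactPoints fun i => ?_
    · simpa using hinj hij
    obtain ⟨u, hu, he, hi⟩ := normalProj_odd x i
    rw [hpt, hc, mk_map_mem_contactPoints hF hH hκ hg (linePoint_ne_zero (-1))
      (by simp [eval_normalCubic])]
    exact vertexImage_mem_contactPoints hx hu (by norm_num) he (hne _) hi
  ext q
  · rw [hlab.points_eq, hesseSalmon, hA, hB, hC]
    constructor
    · rintro ((⟨i, rfl⟩ | ⟨i, rfl⟩) | ⟨i, rfl⟩)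
      exacts [⟨(0, i), rfl⟩, ⟨(1, i), rfl⟩, ⟨(2, i), rfl⟩]
    · rintro ⟨⟨k, i⟩, rfl⟩
      fin_cases k
      exacts [Or.inl (Or.inl ⟨i, rfl⟩), Or.inl (Or.inr ⟨i, rfl⟩), Or.inr ⟨i, rfl⟩]
  · rw [hlab.lines_eq, hesseSalmon, hA, hB, hC]
    constructor
    · rintro ⟨hq, _, ⟨i, rfl⟩, _, ⟨v, rfl⟩, _, -, hiq, hvq, -⟩
      rw [submodule_mk, Submodule.span_singleton_le_iff_mem] at hiq hvq
      refine ⟨(i, v), Submodule.eq_of_le_of_finrank_eq ?_ ((hlab.finrank_line _).trans hq.symm)⟩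
      change (Submodule.span ℂ _).map _ ≤ q
      rw [Submodule.map_span, Set.image_pair, Submodule.span_le]
      rintro _ (rfl | rfl) <;> assumption
    · rintro ⟨l, rfl⟩
      exact ⟨hlab.finrank_line l, _, ⟨l.1, rfl⟩, _, ⟨l.2, rfl⟩, _, ⟨l.1 ^^^ l.2, rfl⟩,
        (hlab.incident_iff (0, l.1) l).2 rfl, (hlab.incident_iff (1, l.2) l).2 rfl,
        (hlab.incident_iff (2, l.1 ^^^ l.2) l).2 rfl⟩

/-- Every Hesse–Salmon configuration is a projection of the cube configuration from a general
point. -/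
theorem IsHesseSalmonDatum.exists_eq_image (h : IsHesseSalmonDatum F a b c) :
    ∃ (ψ : (Fin 4 → ℂ) →ₗ[ℂ] (Fin 3 → ℂ)) (x : Fin 4 → ℂ),
      (Function.Injective fun i => x i ^ 2) ∧ LinearMap.ker ψ ≤ Submodule.span ℂ {x} ∧
      hesseSalmon F a b c = reyeCube.image ψ := by
  obtain ⟨g, x, κ, hκ, hx, hg, ha, hb, hc⟩ := exists_normalForm h
  refine ⟨_, x, hx, ?_, hesseSalmon_eq_image h hκ hx hg ha hb hc⟩
  rw [LinearMap.ker_comp_of_ker_eq_bot _ (LinearMap.ker_eq_bot.2 g.injective), ker_normalProj hx]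

/-- Two projections from the same point differ by a linear automorphism. -/
lemma exists_linearEquiv_comp_eq {p φ : (Fin 4 → ℂ) →ₗ[ℂ] (Fin 3 → ℂ)}
    (hp : Function.Surjective p) (h : LinearMap.ker φ = LinearMap.ker p) :
    ∃ g : (Fin 3 → ℂ) ≃ₗ[ℂ] (Fin 3 → ℂ), φ = g.toLinearMap ∘ₗ p := by
  obtain ⟨s, hs⟩ := p.exists_rightInverse_of_surjective (LinearMap.range_eq_top.2 hp)
  have hps : ∀ u, p (s u) = u := fun u => LinearMap.congr_fun hs u
  refine ⟨LinearEquiv.ofInjectiveEndo (φ ∘ₗ s) ?_, ?_⟩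
  · rw [← LinearMap.ker_eq_bot, LinearMap.ker_eq_bot']
    intro u hu
    have : s u ∈ LinearMap.ker φ := hu
    rw [h, LinearMap.mem_ker, hps] at this
    exact this
  · refine LinearMap.ext fun y => ?_
    have : y - s (p y) ∈ LinearMap.ker φ := by
      rw [h, LinearMap.mem_ker, map_sub, hps, sub_self]
    rw [LinearMap.mem_ker, map_sub, sub_eq_zero] at this
    exact this

/-- The projection of the cube configuration from a general point is a Hesse–Salmon
configuration. -/
theorem exists_hesseSalmon_eq_image {x : Fin 4 → ℂ} (hx : Function.Injective fun i => x i ^ 2)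
    {φ : (Fin 4 → ℂ) →ₗ[ℂ] (Fin 3 → ℂ)} (hφ : LinearMap.ker φ = Submodule.span ℂ {x}) :
    ∃ (F : MvPolynomial (Fin 3) ℂ) (a b c : ℙ ℂ (Fin 3 → ℂ)),
      IsHesseSalmonDatum F a b c ∧ reyeCube.image φ = hesseSalmon F a b c := by
  obtain ⟨g, rfl⟩ := exists_linearEquiv_comp_eq (normalProj_surjective hx)
    (hφ.trans (ker_normalProj hx).symm)
  have hH := isHomogeneous_normalCubic x
  set F := compLin (normalCubic x) g.symm.toLinearMap with hFdef
  have hF : F.IsHomogeneous 3 := isHomogeneous_compLin hH _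
  have hg : ∀ u, eval (g u) F = 1 * eval u (normalCubic x) := fun u => by
    rw [hFdef, eval_compLin, one_mul, LinearEquiv.coe_coe, LinearEquiv.symm_apply_apply]
  have hmem : ∀ (u : Fin 3 → ℂ) (hu : g u ≠ 0), eval u (normalCubic x) = 0 →
      mk ℂ (g u) hu ∈ planeCurve F := fun u hu h => by
    rw [mk_mem_planeCurve hF, hg, h, mul_zero]
  have hneq : ∀ (u v : Fin 3 → ℂ) (hu : g u ≠ 0) (hv : g v ≠ 0), (∀ t : ℂ, t • v ≠ u) →
      mk ℂ (g u) hu ≠ mk ℂ (g v) hv := by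
    intro u v hu hv h heq
    obtain ⟨t, ht⟩ := (mk_eq_mk_iff' ℂ _ _ _ _).1 heq
    rw [← map_smul] at ht
    exact h t (g.injective ht)
  have h : IsHesseSalmonDatum F
      (mk ℂ (g ![0, 0, 1]) ((map_ne_zero_iff g g.injective).2 basisVector_ne_zero))
      (mk ℂ (g ![1, 0, 1]) ((map_ne_zero_iff g g.injective).2 (linePoint_ne_zero 1)))
      (mk ℂ (g ![1, 0, -1]) ((map_ne_zero_iff g g.injective).2 (linePoint_ne_zero (-1)))) := by
    refine ⟨(isNonsingularCubic_map hF hH one_ne_zero hg).2 (isNonsingularCubic_normalCubic hx),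
      hmem _ _ (by simp [eval_normalCubic]), hmem _ _ (by simp [eval_normalCubic]),
      hmem _ _ (by simp [eval_normalCubic]), hneq _ _ _ _ fun t ht => ?_,
      hneq _ _ _ _ fun t ht => ?_, hneq _ _ _ _ fun t ht => ?_, ?_⟩
    · have h0 := congrFun ht 0
      have h2 := congrFun ht 2
      simp at h0 h2
      simp [h0] at h2
    · have h0 := congrFun ht 0
      have h2 := congrFun ht 2
      simp at h0 h2
      rw [h0] at h2
      norm_num at h2
    · have h0 := congrFun ht 0
      have h2 := congrFun ht 2
      simp at h0 h2
      simp [h0] at h2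
    · set f : (Fin 3 → ℂ) →ₗ[ℂ] ℂ := LinearMap.proj 1 ∘ₗ g.symm.toLinearMap with hf
      have hfg : ∀ u, f (g u) = u 1 := fun u => by simp [hf]
      have hsurj : Function.Surjective f := fun t => ⟨g ![0, t, 0], by rw [hfg]; rfl⟩
      refine ⟨LinearMap.ker f, ?_, ?_, ?_, ?_⟩
      · have := LinearMap.finrank_range_add_finrank_ker f
        rw [LinearMap.range_eq_top.2 hsurj, finrank_top] at this
        simp only [Module.finrank_self, Module.finrank_fintype_fun_eq_card,
          Fintype.card_fin] at this
        omega
      all_goals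
        rw [submodule_mk, Submodule.span_singleton_le_iff_mem, LinearMap.mem_ker, hfg]
        rfl
  exact ⟨F, _, _, _, h, (hesseSalmon_eq_image h one_ne_zero hx hg rfl rfl rfl).symm⟩

/-! ### General points for a Reye configuration -/

/-- The product of the linear forms `d_j x_i ± d_i x_j`. If the `d_i` are not zero, it
vanishes at `x` if and only if two of the numbers `(x_i / d_i)²` coincide. -/
def generalityForm (d : Fin 4 → ℂ) : MvPolynomial (Fin 4) ℂ :=
  ∏ p ∈ Finset.univ.filter fun p : Fin 4 × Fin 4 => p.1 < p.2,
    (C (d p.2 ^ 2) * X p.1 ^ 2 - C (d p.1 ^ 2) * X p.2 ^ 2)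

lemma isHomogeneous_generalityForm (d : Fin 4 → ℂ) :
    (generalityForm d).IsHomogeneous
      (∑ _p ∈ Finset.univ.filter fun p : Fin 4 × Fin 4 => p.1 < p.2, 2) :=
  IsHomogeneous.prod _ _ _ fun _ _ =>
    (isHomogeneous_C_mul_X_pow _ _ _).sub (isHomogeneous_C_mul_X_pow _ _ _)

lemma generalityForm_ne_zero {d : Fin 4 → ℂ} (hd : ∀ i, d i ≠ 0) : generalityForm d ≠ 0 := by
  rw [generalityForm, Finset.prod_ne_zero_iff]
  intro p hp h
  have hne : p.2 ≠ p.1 := (Finset.mem_filter.1 hp).2.ne'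
  have := congrArg (eval (Pi.single p.1 1)) h
  simp [hne, hd] at this

lemma injective_of_eval_generalityForm_ne_zero {d : Fin 4 → ℂ} (hd : ∀ i, d i ≠ 0)
    {x : Fin 4 → ℂ} (h : eval x (generalityForm d) ≠ 0) :
    Function.Injective fun i => (x i / d i) ^ 2 := by
  rw [generalityForm, map_prod, Finset.prod_ne_zero_iff] at h
  have key : ∀ i j, i < j → (x i / d i) ^ 2 ≠ (x j / d j) ^ 2 := by
    intro i j hij heq
    apply h (i, j) (by simpa using hij)
    have hi := hd i
    have hj := hd j
    rw [div_pow, div_pow, div_eq_div_iff (pow_ne_zero _ hi) (pow_ne_zero _ hj)] at heq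
    simp
    linear_combination heq
  intro i j hij
  by_contra hne
  rcases lt_or_gt_of_ne hne with hlt | hlt
  · exact key i j hlt hij
  · exact key j i hlt hij.symm

lemma ker_comp_diagMap {d : Fin 4 → ℂ} (hd : ∀ i, d i ≠ 0) {x : Fin 4 → ℂ}
    {φ : (Fin 4 → ℂ) →ₗ[ℂ] (Fin 3 → ℂ)} (hφ : LinearMap.ker φ = Submodule.span ℂ {x}) :
    LinearMap.ker (φ ∘ₗ diagMap d) = Submodule.span ℂ {fun i => x i / d i} := by
  ext v
  rw [LinearMap.mem_ker, LinearMap.comp_apply, ← LinearMap.mem_ker, hφ,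
    Submodule.mem_span_singleton, Submodule.mem_span_singleton]
  refine exists_congr fun t => ?_
  rw [funext_iff, funext_iff]
  refine forall_congr' fun i => ?_
  simp only [Pi.smul_apply, smul_eq_mul, diagMap_apply]
  rw [← mul_div_assoc, div_eq_iff (hd i), mul_comm (v i)]

end ReyeHesseSalmon

end

open ReyeHesseSalmon
theorem mainTheorem4 (R : PointLineSystem 4) (hR : IsReye R) :
    R.IsConfiguration 12 4 16 3 ∧
    (∀ (F : MvPolynomial (Fin 3) ℂ) (a b c : ℙ ℂ (Fin 3 → ℂ)), IsHesseSalmonDatum F a b c →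
      (contactPoints F a).ncard = 4 ∧ (contactPoints F b).ncard = 4 ∧
      (contactPoints F c).ncard = 4 ∧
      (hesseSalmon F a b c).IsConfiguration 12 4 16 3) ∧
    ∃ (d : ℕ) (G : MvPolynomial (Fin 4) ℂ), G.IsHomogeneous d ∧ G ≠ 0 ∧
      ∀ x : ℙ ℂ (Fin 4 → ℂ), MvPolynomial.eval x.rep G ≠ 0 →
        ∀ φ : (Fin 4 → ℂ) →ₗ[ℂ] (Fin 3 → ℂ), LinearMap.ker φ = x.submodule →
          (R.image φ).IsConfiguration 12 4 16 3 ∧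
          (∃ e : R.Iso (R.image φ),
            (∀ p, (e.pointEquiv p).1.submodule = p.1.submodule.map φ) ∧
            ∀ l, (e.lineEquiv l).1 = l.1.map φ) ∧
          (∃ (F : MvPolynomial (Fin 3) ℂ) (a b c : ℙ ℂ (Fin 3 → ℂ)),
            IsHesseSalmonDatum F a b c ∧ R.image φ = hesseSalmon F a b c) ∧
          ∀ (F : MvPolynomial (Fin 3) ℂ) (a b c : ℙ ℂ (Fin 3 → ℂ)),
            IsHesseSalmonDatum F a b c → Nonempty ((R.image φ).Iso (hesseSalmon F a b c)) := by
  obtain ⟨d, hd, rfl⟩ := hR.exists_eq_image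
  have hker : LinearMap.ker (diagMap d) ≤ Submodule.span ℂ {fun i : Fin 4 => ((i : ℕ) : ℂ)} := by
    rw [LinearMap.ker_eq_bot.2 (diagMap_injective hd)]
    exact bot_le
  refine ⟨isConfiguration_image_reyeCube injective_natCast_sq hker, fun F a b c h => ?_,
    _, generalityForm d, isHomogeneous_generalityForm d, generalityForm_ne_zero hd,
    fun x hx φ hφ => ?_⟩
  · obtain ⟨ψ, y, hy, hψ, hS⟩ := h.exists_eq_image
    exact ⟨h.ncard_contactPoints, h.swap_left.ncard_contactPoints, h.rotate.ncard_contactPoints,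
      hS ▸ isConfiguration_image_reyeCube hy hψ⟩
  · have hy := injective_of_eval_generalityForm_ne_zero hd hx
    rw [x.submodule_eq] at hφ
    have hkφ := ker_comp_diagMap hd hφ
    have hlab := isLabelledBy_image_reyeCube injective_natCast_sq hker
    have hlab' := isLabelledBy_image_reyeCube hy hkφ.le
    rw [image_image (diagMap_injective hd)]
    refine ⟨isConfiguration_image_reyeCube hy hkφ.le,
      ⟨hlab.iso hlab' ReyeInc.point_ext ReyeInc.line_ext, fun p => ?_, fun l => ?_⟩,
      exists_hesseSalmon_eq_image hy hkφ, fun F a b c h => ?_⟩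
    · obtain ⟨p, rfl⟩ := (hlab.equivPoints ReyeInc.point_ext).surjective p
      simp only [PointLineSystem.IsLabelledBy.iso, Equiv.trans_apply, Equiv.symm_apply_apply,
        PointLineSystem.IsLabelledBy.coe_equivPoints, Projectivization.submodule_mk,
        Submodule.map_span, Set.image_singleton]
      rfl
    · obtain ⟨l, rfl⟩ := (hlab.equivLines ReyeInc.line_ext).surjective l
      simp only [PointLineSystem.IsLabelledBy.iso, Equiv.trans_apply, Equiv.symm_apply_apply,
        PointLineSystem.IsLabelledBy.coe_equivLines]
      exact Submodule.map_comp _ _ _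
    · obtain ⟨ψ, y', hy', hψ, hS⟩ := h.exists_eq_image
      rw [hS]
      exact ⟨hlab'.iso (isLabelledBy_image_reyeCube hy' hψ) ReyeInc.point_ext ReyeInc.line_ext⟩
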